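/- Let $\alpha>0$, $\Lambda=(-1,1)$, and for $n\in\mathbb N_0$ let $P_n^{\alpha,\alpha}$ be the classical Jacobi polynomial and $$\phi_n(x)=\frac{\sqrt{2n+2\alpha+1}\;n!}{2^{\alpha+\frac12}\,\Gamma(n+\alpha+1)}\,(1-x^2)^{\alpha}P_n^{\alpha,\alpha}(x),\qquad x\in\Lambda .$$ For $v\in L^2(\Lambda)$ let $\tilde v$ be its extension to $\mathbb R$ by zero and $\mathscr F f(\xi)=\int_{\mathbb R}f(x)e^{-\mathrm i x\xi}\,dx$ (extended to $L^2(\mathbb R)$). For $s\ge 0$ let $H^s_*(\Lambda)$ be the space of all $v\in L^2(\Lambda)$ with $\tilde v\in H^s(\mathbb R)$, i.e. $(1+|\xi|^2)^{s/2}\mathscr F\tilde v\in L^2(\mathbb R)$, and for $v\in H^s_*(\Lambda)$ let the Riesz fractional derivative $D^sv\in L^2(\mathbb R)$ be defined by $$\mathscr F(D^sv)(\xi)=(-1)^{\lfloor\frac{s+1}{2}\rfloor}|\xi|^s\,\mathscr F\tilde v(\xi).$$ Then $\phi_n\in H^\alpha_*(\Lambda)$ for all $n\in\mathbb N_0$,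 and for every $N\in\mathbb N_0$ the stiffness matrix $S=(S_{ij})_{0\le i,j\le N}$ and the mass matrix $M=(M_{ij})_{0\le i,j\le N}$ satisfy $$S_{ij}=(D^\alpha\phi_j,D^\alpha\phi_i)_{L^2(\mathbb R)}=\delta_{ij},$$ $$M_{ij}=(\phi_j,\phi_i)_{L^2(\Lambda)}=\begin{cases}\dfrac{(-1)^{\frac{j-i}{2}}\sqrt{\pi(2i+2\alpha+1)(2j+2\alpha+1)}\;\Gamma(2\alpha+1)\,(i+j)!}{2^{2\alpha+i+j+1}\,\Gamma\!\left(2\alpha+\frac{i+j}{2}+\frac32\right)\Gamma\!\left(\alpha+\frac{i-j}{2}+1\right)\Gamma\!\left(\alpha+\frac{j-i}{2}+1\right)\left(\frac{i+j}{2}\right)!}, & i+j\text{ even},\\[2ex] 0,& i+j\text{ odd},\end{cases}$$ where $1/\Gamma(z)$ is understood as $0$ at the poles $z=0,-1,-2,\dots$ of $\Gamma$. -/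

import Mathlib

open MeasureTheory FourierTransform ComplexConjugate

namespace RieszJacobi

/-! ### The interval, inner products and zero extension -/

/-- The interval `Λ = (-1, 1)`. -/
def Lam : Set ℝ := Set.Ioo (-1) 1

/-- The (unweighted) inner product `(u, v)_I = ∫_I u(x) conj(v(x)) dx`. -/
noncomputable def innerOn (I : Set ℝ) (u v : ℝ → ℂ) : ℂ :=
  ∫ x in I, u x * conj (v x)

/-- The extension of `v` from `Λ` to `ℝ` by zero. -/
noncomputable def zeroExt (v : ℝ → ℂ) : ℝ → ℂ := Lam.indicator v

open Classical in
/-- The zero extension of `v` as an element of `L²(ℝ)`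
(with the value `0` if the zero extension is not square integrable). -/
noncomputable def zeroExtL2 (v : ℝ → ℂ) : Lp ℂ 2 (volume : Measure ℝ) :=
  if h : MemLp (zeroExt v) 2 volume then h.toLp else 0

/-! ### The spaces `H^s_*(Λ)` and the Riesz fractional derivative

Mathlib's Fourier transform is `𝓕 f ξ = ∫ f(x) exp(-2πi x ξ) dx`, so a Fourier multiplier with
symbol `m(ξ)` for the convention `∫ f(x) exp(-i x ξ) dx` is multiplication by `m(2πξ)` on the
side of Mathlib's transform. -/

/-- `v ∈ H^s_*(Λ)` for `s ≥ 0`: the zero extension `w` of `v` lies in `H^s(ℝ)`, that is,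
`w ∈ L²(ℝ)` and `(1 + |ξ|²)^(s/2) ŵ(ξ)` is square integrable. -/
def MemHStar (s : ℝ) (v : ℝ → ℂ) : Prop :=
  MemLp (zeroExt v) 2 volume ∧
    MemLp (fun ξ : ℝ => (((1 + (2 * Real.pi * ξ) ^ 2) ^ (s / 2) : ℝ) : ℂ) *
      (𝓕 (zeroExtL2 v) : Lp ℂ 2 (volume : Measure ℝ)) ξ) 2 volume

/-- The symbol `(-1)^⌊(s+1)/2⌋ |ξ|^s` of the Riesz fractional derivative of order `s`. -/
noncomputable def rieszSymbol (s ξ : ℝ) : ℂ :=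
  (-1 : ℂ) ^ ⌊(s + 1) / 2⌋ * ((|ξ| ^ s : ℝ) : ℂ)

open Classical in
/-- The Riesz fractional derivative `D^s v ∈ L²(ℝ)` of a function `v` on `Λ`: the element of
`L²(ℝ)` whose Fourier transform is `(-1)^⌊(s+1)/2⌋ |ξ|^s` times the Fourier transform of the zero
extension of `v`. It exists exactly when that product is square integrable, in particular for all
`v ∈ H^s_*(Λ)`, `s ≥ 0`; otherwise the value is `0`. -/
noncomputable def rieszDeriv (s : ℝ) (v : ℝ → ℂ) : Lp ℂ 2 (volume : Measure ℝ) :=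
  if h : MemLp (fun ξ : ℝ => rieszSymbol s (2 * Real.pi * ξ) *
      (𝓕 (zeroExtL2 v) : Lp ℂ 2 (volume : Measure ℝ)) ξ) 2 volume
  then 𝓕⁻ (h.toLp : Lp ℂ 2 (volume : Measure ℝ)) else 0

/-! ### Generalized Jacobi functions and the normalized basis -/

/-- The classical Jacobi polynomial
`P_n^{a,b}(x) = ∑_{k=0}^n C(n+a, n-k) C(n+b, k) ((x-1)/2)^k ((x+1)/2)^(n-k)`
with generalized binomial coefficients. -/
noncomputable def jacobiP (a b : ℝ) (n : ℕ) (x : ℝ) : ℝ :=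
  ∑ k ∈ Finset.range (n + 1),
    Ring.choose ((n : ℝ) + a) (n - k) * Ring.choose ((n : ℝ) + b) k *
      ((x - 1) / 2) ^ k * ((x + 1) / 2) ^ (n - k)

/-- The generalized Jacobi function `(1 - x²)^α P_n^{α,α}(x)`, for `x ∈ Λ`. -/
noncomputable def genJacobi (α : ℝ) (n : ℕ) (x : ℝ) : ℝ :=
  (1 - x ^ 2) ^ α * jacobiP α α n x

/-- The normalized basis functions `φ_n` (real functions, regarded as complex-valued). -/
noncomputable def basisFun (α : ℝ) (n : ℕ) (x : ℝ) : ℂ :=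
  ((√(2 * n + 2 * α + 1) * (n.factorial : ℝ) /
      ((2 : ℝ) ^ (α + 1 / 2) * Real.Gamma (n + α + 1)) * genJacobi α n x : ℝ) : ℂ)

/-- The stiffness matrix `S_ij = (D^α φ_j, D^α φ_i)`, `0 ≤ i, j ≤ N`. -/
noncomputable def stiffness (α : ℝ) (N : ℕ) : Matrix (Fin (N + 1)) (Fin (N + 1)) ℂ :=
  fun i j => innerOn Set.univ (rieszDeriv α (basisFun α j)) (rieszDeriv α (basisFun α i))

/-- The mass matrix `M_ij = (φ_j, φ_i)`, `0 ≤ i, j ≤ N`. -/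
noncomputable def massMatrix (α : ℝ) (N : ℕ) : Matrix (Fin (N + 1)) (Fin (N + 1)) ℂ :=
  fun i j => innerOn Lam (basisFun α j) (basisFun α i)

/-- The closed form of the entries of the mass matrix with `i + j` even. The reciprocals of the
last two Gamma factors are the values of the entire function `1/Γ`, which is `0` at the poles
of `Γ`; this is also the value of `(Real.Gamma z)⁻¹` in Mathlib at these points. -/
noncomputable def massEntry (α : ℝ) (i j : ℕ) : ℝ :=
  (-1 : ℝ) ^ (((j : ℤ) - (i : ℤ)) / 2) *
      √(Real.pi * (2 * i + 2 * α + 1) * (2 * j + 2 * α + 1)) *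
      Real.Gamma (2 * α + 1) * ((i + j).factorial : ℝ) /
    ((2 : ℝ) ^ (2 * α + i + j + 1) * Real.Gamma (2 * α + ((i : ℝ) + j) / 2 + 3 / 2) *
      (((i + j) / 2).factorial : ℝ)) *
    (Real.Gamma (α + ((i : ℝ) - j) / 2 + 1))⁻¹ * (Real.Gamma (α + ((j : ℝ) - i) / 2 + 1))⁻¹

end RieszJacobi

/-! Stiffness matrix. Integrating by parts `n` times and then using Poisson's integral shows that
the Fourier transform of `φ_n` is a constant times `(-iω)^n |ω|^(-ν) J_ν(|ω|)` with `ν = α + n +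
1/2` (`integral_jacobiP_mul_cexp`, `fourier_zeroExt_basisFun`). The symbol `|ω|^α` turns this into
`|ω|^(-1/2) J_ν(|ω|)`, up to a unimodular factor and a constant. By Plancherel the entries are
therefore integrals of `J_μ J_ν` against `dω/|ω|`, taken over the whole line. If `i + j` is odd the
integrand is odd. If `i + j` is even the orders differ by an even integer, and two facts about
Bessel functions on the half line finish the computation: `∫ J_ν² dt/t = 1/(2ν)`
(`lintegral_besselClifford_sq`), and orthogonality for orders differing by a nonzero even integer
(`integral_besselExp_mul_eq_zero`).

The norm comes from Gegenbauer's formula for `J_ν²` as a Beta average of Bessel functions, combined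
with a Laplace transform. Orthogonality comes from Bessel's equation: in the variable `x` with `t =
2 exp(x/2)`, the product `J_μ J_ν` is a multiple of the derivative of a Wronskian.

Mass matrix. Parity kills the entries with `i + j` odd. For the others, integration by parts moves
degree from one factor to the other at fixed weight `(1 - x²)^(2α)`, until a single Jacobi
polynomial of degree `i + j` remains (`integral_jacobiP_mul_jacobiP`); its parameters are `α - i`. A
two-step recurrence evaluates that integral (`integral_jacobiP_even`). Since the parameters may be
very negative, the Jacobi identities are proved for all real parameters, as polynomial identities.
-/

namespace RieszJacobi

/-! ### Generalized binomial coefficients and identities for Jacobi polynomials -/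

theorem succ_mul_choose_succ (x : ℝ) (k : ℕ) :
    ((k : ℝ) + 1) * Ring.choose x (k + 1) = (x - k) * Ring.choose x k := by
  have h (m : ℕ) : Ring.choose x m = ((m.factorial : ℝ))⁻¹ * (descPochhammer ℤ m).smeval x := by
    rw [Ring.choose_eq_smul, smul_eq_mul]
  rw [h, h, descPochhammer_succ_right, Polynomial.smeval_mul, Nat.factorial_succ]
  have : (Polynomial.X - (k : Polynomial ℤ)).smeval x = x - k := by
    rw [Polynomial.smeval_sub, Polynomial.smeval_X, Polynomial.smeval_natCast]; simp
  rw [this]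
  have := Nat.cast_add_one_pos (α := ℝ) k
  push_cast
  field_simp

theorem choose_eq_Gamma_div (x : ℝ) (k : ℕ) (hx : 0 < x - k + 1) :
    Ring.choose x k = Real.Gamma (x + 1) / (k.factorial * Real.Gamma (x - k + 1)) := by
  induction k with
  | zero =>
    have : 0 < x + 1 := by simpa using hx
    simp [(Real.Gamma_pos_of_pos this).ne']
  | succ k ih =>
    push_cast at hx
    have h0 : 0 < x - k := by linarith
    have h1 := succ_mul_choose_succ x k
    rw [ih (by linarith), Real.Gamma_add_one h0.ne'] at h1
    have := Nat.cast_add_one_pos (α := ℝ) k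
    have h2 : x - ((k + 1 : ℕ) : ℝ) + 1 = x - k := by push_cast; ring
    have h3 := Real.Gamma_pos_of_pos h0
    rw [h2, Nat.factorial_succ]
    have h4 : (k.factorial : ℝ) ≠ 0 := by positivity
    push_cast
    field_simp at h1 ⊢
    linarith

theorem jacobiP_zero (a : ℝ) (x : ℝ) : jacobiP a a 0 x = 1 := by
  simp [jacobiP]

theorem continuous_jacobiP (a b : ℝ) (n : ℕ) : Continuous (jacobiP a b n) := by
  unfold jacobiP
  fun_prop

theorem hasDerivAt_jacobiP_sum (a : ℝ) (n : ℕ) (x : ℝ) :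
    HasDerivAt (jacobiP a a n)
      (∑ k ∈ Finset.range (n + 1), Ring.choose ((n : ℝ) + a) (n - k) * Ring.choose ((n : ℝ) + a) k *
        ((k * ((x - 1) / 2) ^ (k - 1) / 2) * ((x + 1) / 2) ^ (n - k) +
          ((x - 1) / 2) ^ k * ((n - k : ℕ) * ((x + 1) / 2) ^ (n - k - 1) / 2))) x := by
  unfold jacobiP
  refine HasDerivAt.fun_sum fun k _ => ?_
  have h1 : HasDerivAt (fun y : ℝ => (y - 1) / 2) (1 / 2) x :=
    ((hasDerivAt_id x).sub_const 1).div_const 2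
  have h2 : HasDerivAt (fun y : ℝ => (y + 1) / 2) (1 / 2) x :=
    ((hasDerivAt_id x).add_const 1).div_const 2
  have h := ((h1.fun_pow k).fun_mul (h2.fun_pow (n - k))).const_mul
    (Ring.choose ((n : ℝ) + a) (n - k) * Ring.choose ((n : ℝ) + a) k)
  simp only [mul_assoc] at h ⊢
  exact h.congr_deriv (by ring)

theorem hasDerivAt_jacobiP (a : ℝ) (n : ℕ) (x : ℝ) :
    HasDerivAt (jacobiP a a (n + 1)) ((n + 2 * a + 2) / 2 * jacobiP (a + 1) (a + 1) n x) x := by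
  convert hasDerivAt_jacobiP_sum a (n + 1) x using 1
  simp only [mul_add, Finset.sum_add_distrib]
  rw [Finset.sum_range_succ' _ (n + 1)]
  conv_rhs => rw [Finset.sum_range_succ _ (n + 1)]
  simp only [Nat.sub_self, Nat.cast_zero, zero_mul, zero_div, mul_zero, add_zero,
    ← Finset.sum_add_distrib, jacobiP, Finset.mul_sum]
  refine Finset.sum_congr rfl fun k hk => ?_
  obtain ⟨l, rfl⟩ := Nat.exists_eq_add_of_le (Nat.lt_succ_iff.mp (Finset.mem_range.mp hk))
  have e1 : k + l - k = l := by omega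
  have e2 : k + l + 1 - (k + 1) = l := by omega
  have e3 : k + l + 1 - k = l + 1 := by omega
  have e4 : ((k + l : ℕ) : ℝ) + (a + 1) = ((k + l + 1 : ℕ) : ℝ) + a := by push_cast; ring
  simp only [e1, e2, e3, e4, Nat.add_sub_cancel]
  set X : ℝ := ((k + l + 1 : ℕ) : ℝ) + a with hX
  have h1 := succ_mul_choose_succ X k
  have h2 := succ_mul_choose_succ X l
  have e5 : a = X - k - l - 1 := by rw [hX]; push_cast; ring
  push_cast
  rw [e5]
  linear_combination (-(1 / 2) * Ring.choose X l * ((x - 1) / 2) ^ k * ((x + 1) / 2) ^ l) * h1 +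
    (-(1 / 2) * Ring.choose X k * ((x - 1) / 2) ^ k * ((x + 1) / 2) ^ l) * h2

/-- One step of Rodrigues' formula with the power of the weight divided out: `((1 - x²)^(a+1)
P_n^{a+1,a+1})' = -2(n+1) (1 - x²)^a P_{n+1}^{a,a}`. In this form it is a polynomial identity, valid
for every real `a`, and it drives all the integrations by parts. -/
theorem hasDerivAt_jacobiP_raising (a : ℝ) (n : ℕ) (x : ℝ) :
    ∃ d, HasDerivAt (jacobiP (a + 1) (a + 1) n) d x ∧
      (1 - x ^ 2) * d - 2 * (a + 1) * x * jacobiP (a + 1) (a + 1) n x =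
        -2 * (n + 1) * jacobiP a a (n + 1) x := by
  refine ⟨_, hasDerivAt_jacobiP_sum (a + 1) n x, ?_⟩
  -- The factor `n + 1` is split as `(n + 1 - k) + k`. One half loses its last term and the other
  -- its first, and after an index shift both run over the same range as the left side.
  have hsplit : (-2 * ((n : ℝ) + 1)) * jacobiP a a (n + 1) x =
      (-2) * (∑ k ∈ Finset.range (n + 1 + 1), ((n + 1 - k : ℕ) : ℝ) *
        (Ring.choose (((n + 1 : ℕ) : ℝ) + a) (n + 1 - k) * Ring.choose (((n + 1 : ℕ) : ℝ) + a) k *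
          ((x - 1) / 2) ^ k * ((x + 1) / 2) ^ (n + 1 - k))) +
      (-2) * (∑ k ∈ Finset.range (n + 1 + 1), ((k : ℕ) : ℝ) *
        (Ring.choose (((n + 1 : ℕ) : ℝ) + a) (n + 1 - k) * Ring.choose (((n + 1 : ℕ) : ℝ) + a) k *
          ((x - 1) / 2) ^ k * ((x + 1) / 2) ^ (n + 1 - k))) := by
    rw [← mul_add, ← Finset.sum_add_distrib, jacobiP, mul_assoc, Finset.mul_sum]
    congr 1
    refine Finset.sum_congr rfl fun k hk => ?_
    rw [← add_mul, Nat.cast_sub (Nat.lt_succ_iff.mp (Finset.mem_range.mp hk))]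
    push_cast
    ring
  rw [hsplit, Finset.sum_range_succ _ (n + 1)]
  conv_rhs => rw [Finset.sum_range_succ' _ (n + 1)]
  simp only [Nat.sub_self, Nat.cast_zero, zero_mul, add_zero, ← mul_add, ← Finset.sum_add_distrib,
    jacobiP, Finset.mul_sum]
  rw [← Finset.sum_sub_distrib]
  refine Finset.sum_congr rfl fun k hk => ?_
  obtain ⟨l, rfl⟩ := Nat.exists_eq_add_of_le (Nat.lt_succ_iff.mp (Finset.mem_range.mp hk))
  have e1 : k + l - k = l := by omega
  have e2 : k + l + 1 - (k + 1) = l := by omega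
  have e3 : k + l + 1 - k = l + 1 := by omega
  have e4 : ((k + l : ℕ) : ℝ) + (a + 1) = ((k + l + 1 : ℕ) : ℝ) + a := by push_cast; ring
  simp only [e1, e2, e3, e4]
  set X : ℝ := ((k + l + 1 : ℕ) : ℝ) + a with hX
  have h1 := succ_mul_choose_succ X k
  have h2 := succ_mul_choose_succ X l
  have e5 : a = X - k - l - 1 := by rw [hX]; push_cast; ring
  have hp : (k : ℝ) * ((x - 1) / 2) ^ (k - 1) * ((x - 1) / 2) = k * ((x - 1) / 2) ^ k := by
    cases k <;> simp [pow_succ, mul_assoc]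
  have hq : (l : ℝ) * ((x + 1) / 2) ^ (l - 1) * ((x + 1) / 2) = l * ((x + 1) / 2) ^ l := by
    cases l <;> simp [pow_succ, mul_assoc]
  push_cast
  rw [e5]
  linear_combination
    (-2 * Ring.choose X l * Ring.choose X k * ((x + 1) / 2) ^ l * ((x + 1) / 2)) * hp +
    (-2 * Ring.choose X l * Ring.choose X k * ((x - 1) / 2) ^ k * ((x - 1) / 2)) * hq +
    (2 * Ring.choose X l * ((x - 1) / 2) ^ (k + 1) * ((x + 1) / 2) ^ l) * h1 +
    (2 * Ring.choose X k * ((x - 1) / 2) ^ k * ((x + 1) / 2) ^ (l + 1)) * h2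

theorem jacobiP_neg (a : ℝ) (n : ℕ) (x : ℝ) :
    jacobiP a a n (-x) = (-1) ^ n * jacobiP a a n x := by
  unfold jacobiP
  rw [← Finset.sum_range_reflect, Finset.mul_sum]
  refine Finset.sum_congr rfl fun k hk => ?_
  obtain ⟨l, rfl⟩ := Nat.exists_eq_add_of_le (Nat.lt_succ_iff.mp (Finset.mem_range.mp hk))
  have e1 : k + l + 1 - 1 - k = l := by omega
  have e2 : k + l - l = k := by omega
  have e3 : k + l - k = l := by omega
  rw [e1, e2, e3]
  have h1 : (-x - 1) / 2 = (-1) * ((x + 1) / 2) := by ring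
  have h2 : (-x + 1) / 2 = (-1) * ((x - 1) / 2) := by ring
  rw [h1, h2, mul_pow, mul_pow, pow_add]
  ring

/-! ### Beta integrals and moments of the weight `(1 - x²)^γ` -/

theorem beta_integrand_eq_ofReal (a b : ℝ) {x : ℝ} (hx : x ∈ Set.Ioc (0 : ℝ) 1) :
    (x : ℂ) ^ ((a : ℂ) - 1) * (1 - (x : ℂ)) ^ ((b : ℂ) - 1) =
      ((x ^ (a - 1) * (1 - x) ^ (b - 1) : ℝ) : ℂ) := by
  rw [Complex.ofReal_mul, Complex.ofReal_cpow hx.1.le, Complex.ofReal_cpow (by linarith [hx.2])]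
  push_cast
  rfl

theorem intervalIntegrable_beta {a b : ℝ} (ha : 0 < a) (hb : 0 < b) :
    IntervalIntegrable (fun x : ℝ => x ^ (a - 1) * (1 - x) ^ (b - 1)) volume 0 1 := by
  have h := Complex.betaIntegral_convergent (u := a) (v := b) (by simpa) (by simpa)
  rw [intervalIntegrable_iff, Set.uIoc_of_le zero_le_one] at h ⊢
  refine (h.re).congr ?_
  filter_upwards [ae_restrict_mem measurableSet_Ioc] with x hx
  rw [beta_integrand_eq_ofReal a b hx]
  simp

theorem integral_beta {a b : ℝ} (ha : 0 < a) (hb : 0 < b) :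
    ∫ x in (0 : ℝ)..1, x ^ (a - 1) * (1 - x) ^ (b - 1) =
      Real.Gamma a * Real.Gamma b / Real.Gamma (a + b) := by
  have h := ProbabilityTheory.beta_eq_betaIntegralReal a b ha hb
  rw [ProbabilityTheory.beta] at h
  rw [h, Complex.betaIntegral, intervalIntegral.integral_of_le zero_le_one,
    intervalIntegral.integral_of_le zero_le_one,
    setIntegral_congr_fun measurableSet_Ioc (fun x hx => beta_integrand_eq_ofReal a b hx)]
  rw [integral_complex_ofReal, Complex.ofReal_re]

theorem integral_one_sub_sq_rpow {γ : ℝ} (hγ : -1 < γ) :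
    ∫ x in (-1 : ℝ)..1, (1 - x ^ 2) ^ γ =
      √Real.pi * Real.Gamma (γ + 1) / Real.Gamma (γ + 3 / 2) := by
  have h1 := intervalIntegral.integral_comp_mul_sub (a := 0) (b := 1)
    (fun x : ℝ => (1 - x ^ 2) ^ γ) (two_ne_zero) 1
  have h2 : ∫ x in (0 : ℝ)..1, (1 - (2 * x - 1) ^ 2) ^ γ =
      (4 : ℝ) ^ γ * ∫ x in (0 : ℝ)..1, x ^ (γ + 1 - 1) * (1 - x) ^ (γ + 1 - 1) := by
    rw [← intervalIntegral.integral_const_mul]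
    refine intervalIntegral.integral_congr fun x hx => ?_
    rw [Set.uIcc_of_le zero_le_one] at hx
    have e : 1 - (2 * x - 1) ^ 2 = 4 * (x * (1 - x)) := by ring
    have hx1 : 0 ≤ 1 - x := by linarith [hx.2]
    simp only [add_sub_cancel_right]
    rw [e, Real.mul_rpow (by norm_num) (mul_nonneg hx.1 hx1), Real.mul_rpow hx.1 hx1]
  have hp : 0 < γ + 1 := by linarith
  rw [h2, integral_beta hp hp] at h1
  norm_num at h1
  have h3 := Real.Gamma_mul_Gamma_add_half (γ + 1)
  have e1 : γ + 1 + 1 / 2 = γ + 3 / 2 := by ring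
  have e2 : (2 : ℝ) ^ (1 - 2 * (γ + 1)) = (2 * 4 ^ γ)⁻¹ := by
    have : (4 : ℝ) = 2 ^ (2 : ℝ) := by norm_num
    rw [this, ← Real.rpow_mul (by norm_num), show 1 - 2 * (γ + 1) = -(1 + 2 * γ) by ring,
      Real.rpow_neg (by norm_num), Real.rpow_add (by norm_num), Real.rpow_one]
  rw [e1, e2, show 2 * (γ + 1) = γ + 1 + (γ + 1) by ring] at h3
  have g1 := (Real.Gamma_pos_of_pos hp).ne'
  have g2 := (Real.Gamma_pos_of_pos (show 0 < γ + 3 / 2 by linarith)).ne'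
  have g3 := (Real.Gamma_pos_of_pos (show 0 < γ + 1 + (γ + 1) by linarith)).ne'
  have g4 : (4 : ℝ) ^ γ ≠ 0 := by positivity
  rw [eq_div_iff g2]
  generalize Real.Gamma (γ + 1 + (γ + 1)) = G2 at *
  generalize Real.Gamma (γ + 3 / 2) = G1 at *
  generalize Real.Gamma (γ + 1) = G0 at *
  field_simp at h1 h3
  refine mul_right_cancel₀ g3 ?_
  linear_combination -G1 * h1 + G0 * h3

theorem continuous_one_sub_sq_rpow {γ : ℝ} (hγ : 0 ≤ γ) :
    Continuous fun x : ℝ => (1 - x ^ 2) ^ γ :=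
  (by fun_prop : Continuous fun x : ℝ => 1 - x ^ 2).rpow_const fun _ => Or.inr hγ

theorem integral_one_sub_sq_rpow_mul_pow {γ : ℝ} (hγ : 0 ≤ γ) (k : ℕ) :
    ∫ x in (-1 : ℝ)..1, (1 - x ^ 2) ^ γ * x ^ (2 * k) =
      Real.Gamma (k + 1 / 2) * Real.Gamma (γ + 1) / Real.Gamma (γ + k + 3 / 2) := by
  induction k generalizing γ with
  | zero =>
    simpa [← Real.Gamma_one_half_eq] using integral_one_sub_sq_rpow (show -1 < γ by linarith)
  | succ k ih =>
    -- Writing `x² = 1 - (1 - x²)` trades two powers of `x` for a larger `γ`, which is why the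
    -- induction generalizes `γ`.
    have h1 : ∫ x in (-1 : ℝ)..1, (1 - x ^ 2) ^ γ * x ^ (2 * (k + 1)) =
        (∫ x in (-1 : ℝ)..1, (1 - x ^ 2) ^ γ * x ^ (2 * k)) -
        ∫ x in (-1 : ℝ)..1, (1 - x ^ 2) ^ (γ + 1) * x ^ (2 * k) := by
      rw [← intervalIntegral.integral_sub]
      · refine intervalIntegral.integral_congr fun x hx => ?_
        rw [Set.uIcc_of_le (by norm_num)] at hx
        have : 0 ≤ 1 - x ^ 2 := by nlinarith [hx.1, hx.2]
        rw [Real.rpow_add_one' this (by linarith)]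
        ring
      · exact ((continuous_one_sub_sq_rpow hγ).mul (by fun_prop)).intervalIntegrable _ _
      · exact ((continuous_one_sub_sq_rpow (by linarith)).mul
          (by fun_prop)).intervalIntegrable _ _
    rw [h1, ih hγ, ih (by linarith)]
    have hk : (0 : ℝ) ≤ k := k.cast_nonneg
    have e1 : ((k + 1 : ℕ) : ℝ) + 1 / 2 = (k + 1 / 2) + 1 := by push_cast; ring
    have e2 : γ + ((k + 1 : ℕ) : ℝ) + 3 / 2 = (γ + k + 3 / 2) + 1 := by push_cast; ring
    have e3 : γ + 1 + (k : ℝ) + 3 / 2 = (γ + k + 3 / 2) + 1 := by ring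
    rw [e1, e2, e3, Real.Gamma_add_one (by positivity : (k : ℝ) + 1 / 2 ≠ 0),
      Real.Gamma_add_one (by positivity : γ + k + 3 / 2 ≠ 0),
      Real.Gamma_add_one (by positivity : γ + 1 ≠ 0)]
    have g2 := (Real.Gamma_pos_of_pos (show 0 < γ + k + 3 / 2 by positivity)).ne'
    have g3 : γ + k + 3 / 2 ≠ 0 := by positivity
    field_simp
    ring

/-! ### Integration by parts and the mass matrix -/

/-- The integrand is the derivative of `(1 - x²)^(γ+1) q`, which vanishes at both endpoints. The
complex version serves the Fourier integrals, its real form the mass matrix. -/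
theorem integral_one_sub_sq_rpow_mul_deriv {γ : ℝ} (hγ : 0 ≤ γ) {q q' : ℝ → ℂ}
    (hq : ∀ x, HasDerivAt q (q' x) x) (hq' : Continuous q') :
    ∫ x in (-1 : ℝ)..1, (((1 - x ^ 2) ^ γ : ℝ) : ℂ) *
      ((1 - (x : ℂ) ^ 2) * q' x - 2 * (γ + 1) * x * q x) = 0 := by
  have hqc : Continuous q := continuous_iff_continuousAt.mpr fun x => (hq x).continuousAt
  have hc := Complex.continuous_ofReal.comp (continuous_one_sub_sq_rpow hγ)
  have hc1 := Complex.continuous_ofReal.comp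
    (continuous_one_sub_sq_rpow (show 0 ≤ γ + 1 by linarith))
  rw [intervalIntegral.integral_eq_sub_of_hasDerivAt_of_le
    (f := fun x : ℝ => (((1 - x ^ 2) ^ (γ + 1) : ℝ) : ℂ) * q x) (by norm_num)]
  · have : γ + 1 ≠ 0 := by linarith
    norm_num [Real.zero_rpow this]
  · exact (hc1.mul hqc).continuousOn
  · intro x hx
    have hpos : 0 < 1 - x ^ 2 := by nlinarith [hx.1, hx.2]
    have h1 : HasDerivAt (fun x : ℝ => 1 - x ^ 2) (-(2 * x)) x := by
      simpa using ((hasDerivAt_id x).fun_pow 2).const_sub 1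
    have h2 := ((h1.rpow_const (p := γ + 1) (Or.inl hpos.ne')).ofReal_comp).mul (hq x)
    refine h2.congr_deriv ?_
    rw [add_sub_cancel_right, Real.rpow_add_one hpos.ne']
    push_cast
    ring
  · exact (hc.mul (by fun_prop)).intervalIntegrable _ _

theorem integral_one_sub_sq_rpow_mul_deriv_real {γ : ℝ} (hγ : 0 ≤ γ) {q q' : ℝ → ℝ}
    (hq : ∀ x, HasDerivAt q (q' x) x) (hq' : Continuous q') :
    ∫ x in (-1 : ℝ)..1, (1 - x ^ 2) ^ γ * ((1 - x ^ 2) * q' x - 2 * (γ + 1) * x * q x) = 0 := by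
  have h := integral_one_sub_sq_rpow_mul_deriv hγ (fun x => (hq x).ofReal_comp)
    (Complex.continuous_ofReal.comp hq')
  have e : ∀ x : ℝ, (((1 - x ^ 2) ^ γ : ℝ) : ℂ) *
      ((1 - (x : ℂ) ^ 2) * (q' x : ℂ) - 2 * (γ + 1) * x * (q x : ℂ)) =
      (((1 - x ^ 2) ^ γ * ((1 - x ^ 2) * q' x - 2 * (γ + 1) * x * q x) : ℝ) : ℂ) := by
    intro x; push_cast; ring
  simp only [e] at h
  rw [intervalIntegral.integral_ofReal] at h
  exact_mod_cast h

theorem hasDerivAt_jacobiP_deriv (a : ℝ) (n : ℕ) (x : ℝ) :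
    HasDerivAt (jacobiP a a n) (deriv (jacobiP a a n) x) x :=
  (hasDerivAt_jacobiP_sum a n x).differentiableAt.hasDerivAt

theorem continuous_deriv_jacobiP (a : ℝ) (n : ℕ) : Continuous (deriv (jacobiP a a n)) := by
  cases n with
  | zero =>
    have : jacobiP a a 0 = fun _ => 1 := funext (jacobiP_zero a)
    simpa [this] using continuous_const
  | succ n =>
    rw [funext fun x => (hasDerivAt_jacobiP a n x).deriv]
    exact continuous_const.mul (continuous_jacobiP _ _ _)

theorem deriv_jacobiP_raising (a : ℝ) (n : ℕ) (x : ℝ) :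
    (1 - x ^ 2) * deriv (jacobiP (a + 1) (a + 1) n) x -
        2 * (a + 1) * x * jacobiP (a + 1) (a + 1) n x = -2 * (n + 1) * jacobiP a a (n + 1) x := by
  obtain ⟨d, hd, h⟩ := hasDerivAt_jacobiP_raising a n x
  rwa [hd.deriv]

/-- The weight exponent `A + B` is split between the two factors, so that the product rule for `(1 -
x²)^(A+B+1) P_i^{A+1,A+1} P_j^{B,B}` lets the Rodrigues step act on each of them separately. The sum
`A + B` is preserved, so the shift can be iterated. -/
theorem integral_jacobiP_mul_jacobiP_shift {A B : ℝ} (h : 0 ≤ A + B) (i j : ℕ) :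
    ((i : ℝ) + 1) * ∫ x in (-1 : ℝ)..1, (1 - x ^ 2) ^ (A + B) *
        (jacobiP A A (i + 1) x * jacobiP B B j x) =
      -((j + 1) * ∫ x in (-1 : ℝ)..1, (1 - x ^ 2) ^ (A + B) *
        (jacobiP (A + 1) (A + 1) i x * jacobiP (B - 1) (B - 1) (j + 1) x)) := by
  have hd (x : ℝ) := (hasDerivAt_jacobiP_deriv (A + 1) i x).mul (hasDerivAt_jacobiP_deriv B j x)
  have c1 := continuous_jacobiP (A + 1) (A + 1) i
  have c2 := continuous_jacobiP B B j
  have c3 := continuous_jacobiP A A (i + 1)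
  have c4 := continuous_jacobiP (B - 1) (B - 1) (j + 1)
  have c5 := continuous_deriv_jacobiP (A + 1) i
  have c6 := continuous_deriv_jacobiP B j
  have c0 := continuous_one_sub_sq_rpow h
  have key := integral_one_sub_sq_rpow_mul_deriv_real h hd (by fun_prop)
  have e (x : ℝ) : (1 - x ^ 2) ^ (A + B) * ((1 - x ^ 2) *
      (deriv (jacobiP (A + 1) (A + 1) i) x * jacobiP B B j x +
        jacobiP (A + 1) (A + 1) i x * deriv (jacobiP B B j) x) -
      2 * (A + B + 1) * x * (jacobiP (A + 1) (A + 1) i * jacobiP B B j) x) =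
      -2 * ((i + 1) * ((1 - x ^ 2) ^ (A + B) * (jacobiP A A (i + 1) x * jacobiP B B j x)) +
      (j + 1) * ((1 - x ^ 2) ^ (A + B) *
        (jacobiP (A + 1) (A + 1) i x * jacobiP (B - 1) (B - 1) (j + 1) x))) := by
    have h1 := deriv_jacobiP_raising A i x
    have h2 := deriv_jacobiP_raising (B - 1) j x
    rw [sub_add_cancel] at h2
    simp only [Pi.mul_apply]
    linear_combination (1 - x ^ 2) ^ (A + B) * jacobiP B B j x * h1 +
      (1 - x ^ 2) ^ (A + B) * jacobiP (A + 1) (A + 1) i x * h2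
  simp only [e] at key
  rw [intervalIntegral.integral_const_mul, intervalIntegral.integral_add,
    intervalIntegral.integral_const_mul, intervalIntegral.integral_const_mul] at key
  · linarith
  · exact Continuous.intervalIntegrable (by fun_prop) _ _
  · exact Continuous.intervalIntegrable (by fun_prop) _ _

theorem integral_jacobiP_mul_jacobiP {γ : ℝ} (h : 0 ≤ γ) (i : ℕ) :
    ∀ (j : ℕ) (A B : ℝ), A + B = γ →
    ((i.factorial : ℝ) * j.factorial) * ∫ x in (-1 : ℝ)..1, (1 - x ^ 2) ^ γ *
        (jacobiP A A i x * jacobiP B B j x) =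
      (-1) ^ i * (i + j).factorial * ∫ x in (-1 : ℝ)..1, (1 - x ^ 2) ^ γ *
        jacobiP (B - i) (B - i) (i + j) x := by
  induction i with
  | zero => intro j A B _; simp [jacobiP_zero]
  | succ i ih =>
    intro j A B hAB
    have h1 := integral_jacobiP_mul_jacobiP_shift (hAB ▸ h) i j
    have h2 := ih (j + 1) (A + 1) (B - 1) (by linarith)
    rw [hAB] at h1
    have e1 : i + 1 + j = i + (j + 1) := by ring
    have e2 : B - ((i + 1 : ℕ) : ℝ) = B - 1 - i := by push_cast; ring
    rw [e1, e2, pow_succ, mul_comm ((-1 : ℝ) ^ i), mul_assoc (-1 : ℝ), mul_assoc (-1 : ℝ), ← h2,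
      Nat.factorial_succ, Nat.factorial_succ]
    push_cast
    linear_combination (i.factorial * j.factorial : ℝ) * h1

/-- Both the derivative formula and the Rodrigues step involve `X = ∫ (1 - x²)^γ x
P_{n+1}^{B+1,B+1}`; eliminating `X` lowers the degree by two. The difference `γ - B` drops by one
each time, which produces the falling product in `integral_jacobiP_even`. -/
theorem integral_jacobiP_succ_succ {γ : ℝ} (h : 0 ≤ γ) (n : ℕ) (B : ℝ) :
    ((n : ℝ) + 2) * ∫ x in (-1 : ℝ)..1, (1 - x ^ 2) ^ γ * jacobiP B B (n + 2) x =
      -((γ - B) * (n + 2 * B + 4) / (4 * (γ + 1)) *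
        ∫ x in (-1 : ℝ)..1, (1 - x ^ 2) ^ (γ + 1) * jacobiP (B + 2) (B + 2) n x) := by
  have hd (x : ℝ) : HasDerivAt (jacobiP (B + 1) (B + 1) (n + 1))
      ((n + 2 * B + 4) / 2 * jacobiP (B + 2) (B + 2) n x) x := by
    have := hasDerivAt_jacobiP (B + 1) n x
    rw [show B + 1 + 1 = B + 2 by ring] at this
    exact this.congr_deriv (by ring)
  have c0 := continuous_one_sub_sq_rpow h
  have c1 := continuous_one_sub_sq_rpow (show 0 ≤ γ + 1 by linarith)
  have c2 := continuous_jacobiP (B + 2) (B + 2) n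
  have c3 := continuous_jacobiP B B (n + 2)
  have c4 := continuous_jacobiP (B + 1) (B + 1) (n + 1)
  have key := integral_one_sub_sq_rpow_mul_deriv_real h hd (by fun_prop)
  have hx {x : ℝ} (hx : x ∈ Set.uIcc (-1 : ℝ) 1) : 0 ≤ 1 - x ^ 2 := by
    rw [Set.uIcc_of_le (by norm_num)] at hx
    nlinarith [hx.1, hx.2]
  have h1 : ∫ x in (-1 : ℝ)..1, (1 - x ^ 2) ^ γ *
      ((1 - x ^ 2) * ((n + 2 * B + 4) / 2 * jacobiP (B + 2) (B + 2) n x) -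
        2 * (γ + 1) * x * jacobiP (B + 1) (B + 1) (n + 1) x) =
      (n + 2 * B + 4) / 2 * (∫ x in (-1 : ℝ)..1, (1 - x ^ 2) ^ (γ + 1) *
        jacobiP (B + 2) (B + 2) n x) - (2 * (γ + 1)) *
      ∫ x in (-1 : ℝ)..1, (1 - x ^ 2) ^ γ * (x * jacobiP (B + 1) (B + 1) (n + 1) x) := by
    rw [← intervalIntegral.integral_const_mul, ← intervalIntegral.integral_const_mul,
      ← intervalIntegral.integral_sub]
    · refine intervalIntegral.integral_congr fun x hx' => ?_
      rw [Real.rpow_add_one' (hx hx') (by linarith)]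
      ring
    · exact Continuous.intervalIntegrable (by fun_prop) _ _
    · exact Continuous.intervalIntegrable (by fun_prop) _ _
  have h2 : ∫ x in (-1 : ℝ)..1, (1 - x ^ 2) ^ γ *
      ((1 - x ^ 2) * ((n + 2 * B + 4) / 2 * jacobiP (B + 2) (B + 2) n x) -
        2 * (γ + 1) * x * jacobiP (B + 1) (B + 1) (n + 1) x) =
      (-2 * (n + 2)) * (∫ x in (-1 : ℝ)..1, (1 - x ^ 2) ^ γ * jacobiP B B (n + 2) x) -
      (2 * (γ - B)) *
      ∫ x in (-1 : ℝ)..1, (1 - x ^ 2) ^ γ * (x * jacobiP (B + 1) (B + 1) (n + 1) x) := by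
    rw [← intervalIntegral.integral_const_mul, ← intervalIntegral.integral_const_mul,
      ← intervalIntegral.integral_sub]
    · refine intervalIntegral.integral_congr fun x _ => ?_
      have h3 := deriv_jacobiP_raising B (n + 1) x
      rw [(hd x).deriv] at h3
      push_cast at h3
      simp only [show n + 1 + 1 = n + 2 by ring] at h3
      linear_combination (1 - x ^ 2) ^ γ * h3
    · exact Continuous.intervalIntegrable (by fun_prop) _ _
    · exact Continuous.intervalIntegrable (by fun_prop) _ _
  have hγ : γ + 1 ≠ 0 := by linarith
  rw [key] at h1 h2
  generalize (∫ x in (-1 : ℝ)..1, (1 - x ^ 2) ^ γ * (x * jacobiP (B + 1) (B + 1) (n + 1) x)) = X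
    at *
  have hX : X = (n + 2 * B + 4) / (4 * (γ + 1)) * ∫ x in (-1 : ℝ)..1, (1 - x ^ 2) ^ (γ + 1) *
        jacobiP (B + 2) (B + 2) n x := by
    field_simp
    linarith
  rw [hX] at h2
  linear_combination (1 / 2) * h2

theorem integral_jacobiP_even (m : ℕ) : ∀ {γ : ℝ}, 0 ≤ γ → ∀ B : ℝ,
    ∫ x in (-1 : ℝ)..1, (1 - x ^ 2) ^ γ * jacobiP B B (2 * m) x =
      (-1) ^ m / (4 ^ m * m.factorial) * (∏ l ∈ Finset.range m, (γ - B - l)) *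
        (∏ l ∈ Finset.range m, (m + B + 1 + l)) *
        (√Real.pi * Real.Gamma (γ + 1) / Real.Gamma (γ + m + 3 / 2)) := by
  induction m with
  | zero =>
    intro γ h B
    simpa [jacobiP_zero] using integral_one_sub_sq_rpow (show -1 < γ by linarith)
  | succ m ih =>
    intro γ h B
    have h1 := integral_jacobiP_succ_succ h (2 * m) B
    rw [ih (show 0 ≤ γ + 1 by linarith) (B + 2)] at h1
    rw [show 2 * (m + 1) = 2 * m + 2 by ring, Finset.prod_range_succ', Finset.prod_range_succ',
      Nat.factorial_succ]
    have e1 : ∏ l ∈ Finset.range m, (γ + 1 - (B + 2) - (l : ℝ)) =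
        ∏ l ∈ Finset.range m, (γ - B - ((l + 1 : ℕ) : ℝ)) :=
      Finset.prod_congr rfl fun l _ => by push_cast; ring
    have e2 : ∏ l ∈ Finset.range m, (m + (B + 2) + 1 + (l : ℝ)) =
        ∏ l ∈ Finset.range m, (((m + 1 : ℕ) : ℝ) + B + 1 + ((l + 1 : ℕ) : ℝ)) :=
      Finset.prod_congr rfl fun l _ => by push_cast; ring
    have e3 : γ + 1 + m + 3 / 2 = γ + ((m + 1 : ℕ) : ℝ) + 3 / 2 := by push_cast; ring
    have hγ : γ + 1 ≠ 0 := by linarith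
    rw [e1, e2, e3, Real.Gamma_add_one hγ] at h1
    have hm : (0 : ℝ) ≤ m := m.cast_nonneg
    have g := (Real.Gamma_pos_of_pos (show 0 < γ + ((m + 1 : ℕ) : ℝ) + 3 / 2 by positivity)).ne'
    generalize ∏ l ∈ Finset.range m, (γ - B - ((l + 1 : ℕ) : ℝ)) = X at *
    generalize ∏ l ∈ Finset.range m, (((m + 1 : ℕ) : ℝ) + B + 1 + ((l + 1 : ℕ) : ℝ)) = Y at *
    generalize Real.Gamma (γ + ((m + 1 : ℕ) : ℝ) + 3 / 2) = G at *
    generalize Real.Gamma (γ + 1) = G1 at *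
    have hm2 : ((2 * m : ℕ) : ℝ) + 2 ≠ 0 := by positivity
    refine mul_left_cancel₀ hm2 (h1.trans ?_)
    have hf : (m.factorial : ℝ) ≠ 0 := by positivity
    push_cast
    field_simp
    ring

/-- No restriction on `z` is needed: at a pole `Real.Gamma` is `0`, so its inverse is `0` as well,
in agreement with the entire function `1/Γ`. Thus the mass matrix formula needs no case distinction
at the poles. -/
theorem inv_Gamma_eq_prod_mul_inv_Gamma (z : ℝ) (m : ℕ) :
    (Real.Gamma z)⁻¹ = (∏ l ∈ Finset.range m, (z + l)) * (Real.Gamma (z + m))⁻¹ := by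
  induction m with
  | zero => simp
  | succ m ih =>
    rw [ih, Finset.prod_range_succ, mul_assoc]
    congr 1
    push_cast
    rw [← add_assoc]
    by_cases h : z + m = 0
    · simp [h, Real.Gamma_zero]
    · rw [Real.Gamma_add_one h, mul_inv, mul_inv_cancel_left₀ h]

theorem innerOn_basisFun (α : ℝ) (i j : ℕ) :
    innerOn Lam (basisFun α j) (basisFun α i) =
      (((√(2 * j + 2 * α + 1) * (j.factorial : ℝ) /
        ((2 : ℝ) ^ (α + 1 / 2) * Real.Gamma (j + α + 1))) *
      (√(2 * i + 2 * α + 1) * (i.factorial : ℝ) /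
        ((2 : ℝ) ^ (α + 1 / 2) * Real.Gamma (i + α + 1))) *
      ∫ x in (-1 : ℝ)..1, (1 - x ^ 2) ^ (2 * α) * (jacobiP α α i x * jacobiP α α j x) : ℝ) : ℂ) := by
  rw [intervalIntegral.integral_of_le (by norm_num), integral_Ioc_eq_integral_Ioo,
    ← integral_const_mul, ← integral_complex_ofReal]
  refine setIntegral_congr_fun measurableSet_Ioo fun x hx => ?_
  have hpos : 0 < 1 - x ^ 2 := by nlinarith [hx.1, hx.2]
  simp only [basisFun, genJacobi, Complex.conj_ofReal]
  rw [← Complex.ofReal_mul, two_mul α, Real.rpow_add hpos]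
  congr 1
  ring

theorem innerOn_basisFun_of_odd (α : ℝ) {i j : ℕ} (h : ¬ Even (i + j)) :
    innerOn Lam (basisFun α j) (basisFun α i) = 0 := by
  rw [innerOn_basisFun]
  have h1 : ∫ x in (-1 : ℝ)..1, (1 - x ^ 2) ^ (2 * α) * (jacobiP α α i x * jacobiP α α j x) =
      -∫ x in (-1 : ℝ)..1, (1 - x ^ 2) ^ (2 * α) * (jacobiP α α i x * jacobiP α α j x) := by
    conv_lhs => rw [← neg_neg (1 : ℝ), ← intervalIntegral.integral_comp_neg, neg_neg]
    rw [← intervalIntegral.integral_neg]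
    refine intervalIntegral.integral_congr fun x _ => ?_
    have h2 : (-1 : ℝ) ^ i * (-1) ^ j = -1 := by
      rw [← pow_add, (Nat.not_even_iff_odd.mp h).neg_one_pow]
    simp only [jacobiP_neg, neg_sq]
    linear_combination ((1 - x ^ 2) ^ (2 * α) * (jacobiP α α i x * jacobiP α α j x)) * h2
  rw [show ∫ x in (-1 : ℝ)..1, (1 - x ^ 2) ^ (2 * α) * (jacobiP α α i x * jacobiP α α j x) = 0
    by linarith]
  simp

theorem innerOn_basisFun_of_even {α : ℝ} (hα : 0 < α) {i j : ℕ} (h : Even (i + j)) :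
    innerOn Lam (basisFun α j) (basisFun α i) = ((massEntry α i j : ℝ) : ℂ) := by
  rw [innerOn_basisFun]
  congr 1
  obtain ⟨m, hm⟩ := h
  have hm2 : i + j = 2 * m := by omega
  have hmr : ((i : ℝ) + j) / 2 = m := by
    have : ((i + j : ℕ) : ℝ) = ((2 * m : ℕ) : ℝ) := by rw [hm2]
    push_cast at this
    linarith
  have hi : (0 : ℝ) ≤ i := i.cast_nonneg
  have hj : (0 : ℝ) ≤ j := j.cast_nonneg
  have hm0 : (0 : ℝ) ≤ m := m.cast_nonneg
  have h1 := integral_jacobiP_mul_jacobiP (show 0 ≤ 2 * α by linarith) i j α α (by ring)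
  rw [hm2, integral_jacobiP_even m (show 0 ≤ 2 * α by linarith)] at h1
  have p1 := inv_Gamma_eq_prod_mul_inv_Gamma (α + ((i : ℝ) - j) / 2 + 1) m
  have p2 := inv_Gamma_eq_prod_mul_inv_Gamma (α + ((j : ℝ) - i) / 2 + 1) m
  rw [show α + ((i : ℝ) - j) / 2 + 1 + m = i + α + 1 by rw [← hmr]; ring] at p1
  rw [show α + ((j : ℝ) - i) / 2 + 1 + m = j + α + 1 by rw [← hmr]; ring] at p2
  have q1 : ∏ l ∈ Finset.range m, (2 * α - (α - i) - (l : ℝ)) =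
      ∏ l ∈ Finset.range m, (α + ((i : ℝ) - j) / 2 + 1 + l) := by
    rw [← Finset.prod_range_reflect]
    refine Finset.prod_congr rfl fun l hl => ?_
    have hl := Finset.mem_range.mp hl
    rw [Nat.cast_sub (by omega), Nat.cast_sub (by omega)]
    push_cast
    linear_combination hmr
  have q2 : ∏ l ∈ Finset.range m, (m + (α - i) + 1 + (l : ℝ)) =
      ∏ l ∈ Finset.range m, (α + ((j : ℝ) - i) / 2 + 1 + l) :=
    Finset.prod_congr rfl fun l _ => by linear_combination -hmr
  rw [q1, q2] at h1
  have hs : (-1 : ℝ) ^ (((j : ℤ) - (i : ℤ)) / 2) = (-1) ^ i * (-1) ^ m := by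
    -- The integer division is exact because `i + j = 2m`.
    have : ((j : ℤ) - (i : ℤ)) / 2 = (m : ℤ) - i := by omega
    rw [this, zpow_sub₀ (by norm_num), zpow_natCast, zpow_natCast, div_eq_mul_inv, ← inv_pow]
    norm_num [mul_comm]
  have h2 : (2 : ℝ) ^ (2 * α + i + j + 1) =
      ((2 : ℝ) ^ (α + 1 / 2) * (2 : ℝ) ^ (α + 1 / 2)) * 4 ^ m := by
    rw [show (4 : ℝ) = 2 ^ 2 by norm_num, ← pow_mul, ← Real.rpow_natCast, ← Real.rpow_add two_pos,
      ← Real.rpow_add two_pos]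
    congr 1
    push_cast
    linear_combination 2 * hmr
  have hsq : √(Real.pi * (2 * i + 2 * α + 1) * (2 * j + 2 * α + 1)) =
      √Real.pi * √(2 * i + 2 * α + 1) * √(2 * j + 2 * α + 1) := by
    rw [Real.sqrt_mul (by positivity), Real.sqrt_mul (by positivity)]
  rw [massEntry, hs, h2, hsq, hmr, hm2, Nat.mul_div_cancel_left m two_pos, p1, p2]
  have g1 := (Real.Gamma_pos_of_pos (show 0 < i + α + 1 by positivity)).ne'
  have g2 := (Real.Gamma_pos_of_pos (show 0 < j + α + 1 by positivity)).ne'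
  have g3 := (Real.Gamma_pos_of_pos (show 0 < 2 * α + m + 3 / 2 by positivity)).ne'
  have hw : (2 : ℝ) ^ (α + 1 / 2) ≠ 0 := by positivity
  generalize ∏ l ∈ Finset.range m, (α + ((i : ℝ) - j) / 2 + 1 + l) = X at *
  generalize ∏ l ∈ Finset.range m, (α + ((j : ℝ) - i) / 2 + 1 + l) = Y at *
  generalize ∫ x in (-1 : ℝ)..1, (1 - x ^ 2) ^ (2 * α) * (jacobiP α α i x * jacobiP α α j x) = K
    at *
  generalize Real.Gamma (i + α + 1) = G1 at *
  generalize Real.Gamma (j + α + 1) = G2 at *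
  generalize Real.Gamma (2 * α + m + 3 / 2) = G3 at *
  generalize Real.Gamma (2 * α + 1) = G4 at *
  generalize (2 : ℝ) ^ (α + 1 / 2) = w at *
  have hf1 : (m.factorial : ℝ) ≠ 0 := by positivity
  calc _ = √(2 * j + 2 * α + 1) * √(2 * i + 2 * α + 1) / (w * G2 * (w * G1)) *
        (i.factorial * j.factorial * K) := by ring
    _ = _ := by
      rw [h1]
      field_simp

/-! ### The Bessel–Clifford function: series, derivative, recurrence and Poisson's integral -/

/-- The coefficients `1 / (k! Γ(ν + k + 1))` of the Bessel function `(t/2)^(-ν) J_ν(t)`. -/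
noncomputable def besselCoeff (ν : ℝ) (k : ℕ) : ℝ :=
  ((k.factorial : ℝ) * Real.Gamma (ν + k + 1))⁻¹

/-- The Bessel–Clifford function, with `J_ν(t) = (t/2)^ν * besselClifford ν (t^2/4)`. -/
noncomputable def besselClifford (ν y : ℝ) : ℝ :=
  ∑' k : ℕ, (-1) ^ k * besselCoeff ν k * y ^ k

theorem besselCoeff_pos {ν : ℝ} (hν : 0 ≤ ν) (k : ℕ) : 0 < besselCoeff ν k := by
  have := Real.Gamma_pos_of_pos (show 0 < ν + k + 1 by positivity)
  unfold besselCoeff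
  positivity

theorem besselCoeff_succ_mul {ν : ℝ} (k : ℕ) :
    (k + 1) * besselCoeff ν (k + 1) = besselCoeff (ν + 1) k := by
  unfold besselCoeff
  rw [show ν + ((k + 1 : ℕ) : ℝ) + 1 = ν + 1 + k + 1 by push_cast; ring, Nat.factorial_succ]
  have := Nat.cast_add_one_pos (α := ℝ) k
  push_cast
  rw [mul_inv, mul_inv, mul_inv]
  field_simp

theorem besselCoeff_eq_mul {ν : ℝ} (hν : 0 ≤ ν) (k : ℕ) :
    besselCoeff ν k = (ν + k + 1) * besselCoeff (ν + 1) k := by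
  unfold besselCoeff
  have h : ν + k + 1 ≠ 0 := by positivity
  rw [show ν + 1 + (k : ℝ) + 1 = ν + k + 1 + 1 by ring, Real.Gamma_add_one h]
  have g := (Real.Gamma_pos_of_pos (show 0 < ν + k + 1 by positivity)).ne'
  field_simp

theorem Gamma_le_Gamma_add_nat {z : ℝ} (hz : 1 ≤ z) (k : ℕ) :
    Real.Gamma z ≤ Real.Gamma (z + k) := by
  induction k with
  | zero => simp
  | succ k ih =>
    have hk : (0 : ℝ) ≤ k := k.cast_nonneg
    have hp : 0 < z + k := by linarith
    refine ih.trans ?_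
    push_cast
    rw [← add_assoc, Real.Gamma_add_one hp.ne']
    exact le_mul_of_one_le_left (Real.Gamma_pos_of_pos hp).le (by linarith)

theorem besselCoeff_le {ν : ℝ} (hν : 0 ≤ ν) (k : ℕ) :
    besselCoeff ν k ≤ (Real.Gamma (ν + 1))⁻¹ * (k.factorial : ℝ)⁻¹ := by
  have h := Gamma_le_Gamma_add_nat (show 1 ≤ ν + 1 by linarith) k
  have g := Real.Gamma_pos_of_pos (show 0 < ν + 1 by linarith)
  rw [besselCoeff, mul_comm, mul_inv, show ν + (k : ℝ) + 1 = ν + 1 + k by ring]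
  gcongr

theorem summable_besselCoeff_mul_pow {ν : ℝ} (hν : 0 ≤ ν) (r : ℝ) :
    Summable fun k => besselCoeff ν k * r ^ k := by
  have h := (Real.summable_pow_div_factorial |r|).mul_left (Real.Gamma (ν + 1))⁻¹
  refine Summable.of_norm_bounded h fun k => ?_
  rw [norm_mul, norm_pow, Real.norm_eq_abs, Real.norm_eq_abs, abs_of_pos (besselCoeff_pos hν k)]
  calc besselCoeff ν k * |r| ^ k ≤ (Real.Gamma (ν + 1))⁻¹ * (k.factorial : ℝ)⁻¹ * |r| ^ k := by
        gcongr; exact besselCoeff_le hν k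
    _ = _ := by ring

theorem summable_besselClifford {ν : ℝ} (hν : 0 ≤ ν) (y : ℝ) :
    Summable fun k => (-1) ^ k * besselCoeff ν k * y ^ k := by
  refine (summable_besselCoeff_mul_pow hν (-y)).congr fun k => ?_
  rw [neg_pow]
  ring

theorem norm_besselClifford_term {ν : ℝ} (hν : 0 ≤ ν) (y : ℝ) (k : ℕ) :
    ‖(-1) ^ k * besselCoeff ν k * y ^ k‖ = besselCoeff ν k * |y| ^ k := by
  simp [abs_of_pos (besselCoeff_pos hν k)]

theorem hasDerivAt_besselClifford {ν : ℝ} (hν : 0 ≤ ν) (y : ℝ) :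
    HasDerivAt (besselClifford ν) (-besselClifford (ν + 1) y) y := by
  -- The ball of radius `R` contains both `0` and `y`, and the differentiated series has a summable
  -- uniform bound there.
  set R : ℝ := |y| + 1
  have hR : 0 ≤ R := by positivity
  have hν1 : 0 ≤ ν + 1 := by linarith
  have hu : Summable fun k : ℕ => besselCoeff ν k * (k * R ^ (k - 1)) := by
    rw [← summable_nat_add_iff 1]
    refine (summable_besselCoeff_mul_pow hν1 R).congr fun k => ?_
    rw [← besselCoeff_succ_mul]
    simp only [Nat.add_sub_cancel]
    push_cast
    ring
  have h := hasDerivAt_tsum_of_isPreconnected (t := Metric.ball (0 : ℝ) R) (y₀ := 0) (y := y)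
    (g := fun (k : ℕ) (z : ℝ) => (-1) ^ k * besselCoeff ν k * z ^ k)
    (g' := fun (k : ℕ) (z : ℝ) => (-1) ^ k * besselCoeff ν k * (k * z ^ (k - 1)))
    hu Metric.isOpen_ball (convex_ball 0 R).isPreconnected
    (fun k z _ => (hasDerivAt_pow k z).const_mul _) (fun k z hz => by
      have hz' : |z| ≤ R := by simpa using (Metric.mem_ball.mp hz).le
      rw [norm_mul, norm_mul, norm_mul, norm_pow, norm_pow]
      simp only [norm_neg, norm_one, one_pow, one_mul, Real.norm_eq_abs, Nat.abs_cast,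
        abs_of_pos (besselCoeff_pos hν k)]
      gcongr
      exact (besselCoeff_pos hν k).le)
    (by simp only [Metric.mem_ball, dist_self]; positivity) (summable_besselClifford hν 0)
    (by simp [R])
  refine h.congr_deriv ?_
  have hs : Summable fun k : ℕ => (-1) ^ k * besselCoeff ν k * (k * y ^ (k - 1)) := by
    refine Summable.of_norm_bounded hu fun k => ?_
    rw [norm_mul, norm_mul, norm_mul, norm_pow, norm_pow]
    simp only [norm_neg, norm_one, one_pow, one_mul, Real.norm_eq_abs, Nat.abs_cast,
      abs_of_pos (besselCoeff_pos hν k)]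
    gcongr
    · exact (besselCoeff_pos hν k).le
    · simp [R]
  rw [hs.tsum_eq_zero_add, besselClifford, ← tsum_neg]
  simp only [Nat.cast_zero, zero_mul, mul_zero, zero_add]
  refine tsum_congr fun k => ?_
  rw [← besselCoeff_succ_mul]
  simp only [Nat.add_sub_cancel]
  push_cast
  ring

theorem continuous_besselClifford {ν : ℝ} (hν : 0 ≤ ν) : Continuous (besselClifford ν) :=
  continuous_iff_continuousAt.mpr fun y => (hasDerivAt_besselClifford hν y).continuousAt

theorem besselClifford_recurrence {ν : ℝ} (hν : 0 ≤ ν) (y : ℝ) :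
    besselClifford ν y =
      (ν + 1) * besselClifford (ν + 1) y - y * besselClifford (ν + 2) y := by
  have h1 := summable_besselClifford (show 0 ≤ ν + 1 by linarith) y
  have h2 := summable_besselClifford (show 0 ≤ ν + 2 by linarith) y
  have h0 := summable_besselClifford hν y
  have h3 : besselClifford ν y - (ν + 1) * besselClifford (ν + 1) y =
      ∑' k : ℕ, (-1) ^ k * (k * besselCoeff (ν + 1) k) * y ^ k := by
    unfold besselClifford
    rw [← tsum_mul_left, ← h0.tsum_sub (h1.mul_left _)]
    refine tsum_congr fun k => ?_
    rw [besselCoeff_eq_mul hν]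
    ring
  have h4 : Summable fun k : ℕ => (-1) ^ k * (k * besselCoeff (ν + 1) k) * y ^ k := by
    refine (h0.sub (h1.mul_left (ν + 1))).congr fun k => ?_
    rw [besselCoeff_eq_mul hν]
    ring
  have h5 : ∑' k : ℕ, (-1) ^ k * (k * besselCoeff (ν + 1) k) * y ^ k =
      -(y * besselClifford (ν + 2) y) := by
    rw [h4.tsum_eq_zero_add, besselClifford, ← tsum_mul_left, ← tsum_neg]
    simp only [Nat.cast_zero, zero_mul, mul_zero, zero_add]
    refine tsum_congr fun k => ?_
    rw [show ν + 2 = ν + 1 + 1 by ring, ← besselCoeff_succ_mul (ν := ν + 1)]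
    push_cast
    ring
  linarith

/-- Poisson's integral for `J_{β+1/2}`: the cosine is expanded and integrated term by term against
the even moments of the weight. -/
theorem integral_one_sub_sq_rpow_mul_cos {β : ℝ} (hβ : 0 ≤ β) (ξ : ℝ) :
    ∫ x in (-1 : ℝ)..1, (1 - x ^ 2) ^ β * Real.cos (x * ξ) =
      √Real.pi * Real.Gamma (β + 1) * besselClifford (β + 1 / 2) (ξ ^ 2 / 4) := by
  have hc := continuous_one_sub_sq_rpow hβ
  have h1 : HasSum (fun k : ℕ => ∫ x in (-1 : ℝ)..1,
      (1 - x ^ 2) ^ β * ((-1) ^ k * (x * ξ) ^ (2 * k) / (2 * k).factorial))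
      (∫ x in (-1 : ℝ)..1, (1 - x ^ 2) ^ β * Real.cos (x * ξ)) := by
    refine intervalIntegral.hasSum_integral_of_dominated_convergence
      (fun (k : ℕ) (_ : ℝ) => |ξ| ^ (2 * k) / (2 * k).factorial) (fun k => ?_) (fun k => ?_) ?_ ?_ ?_
    · exact Continuous.aestronglyMeasurable (by fun_prop)
    · refine Filter.Eventually.of_forall fun x hx => ?_
      rw [Set.uIoc_of_le (by norm_num)] at hx
      have h0 : 0 ≤ 1 - x ^ 2 := by nlinarith [hx.1, hx.2]
      have hx1 : |x| ≤ 1 := abs_le.mpr ⟨hx.1.le, hx.2⟩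
      have e1 : (1 - x ^ 2) ^ β ≤ 1 := Real.rpow_le_one h0 (by nlinarith [sq_nonneg x]) hβ
      have e2 : |x| ^ (2 * k) ≤ 1 := pow_le_one₀ (abs_nonneg x) hx1
      rw [norm_mul, norm_div, norm_mul, norm_pow, norm_pow]
      simp only [norm_neg, norm_one, one_pow, one_mul, Real.norm_eq_abs, Nat.abs_cast, abs_mul]
      rw [abs_of_nonneg (Real.rpow_nonneg h0 β), mul_pow]
      calc (1 - x ^ 2) ^ β * (|x| ^ (2 * k) * |ξ| ^ (2 * k) / (2 * k).factorial) ≤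
            1 * (1 * |ξ| ^ (2 * k) / (2 * k).factorial) := by gcongr
        _ = _ := by ring
    · exact Filter.Eventually.of_forall fun _ _ =>
        (Real.summable_pow_div_factorial |ξ|).comp_injective (mul_right_injective₀ two_ne_zero)
    · exact intervalIntegrable_const
    · exact Filter.Eventually.of_forall fun x _ => (Real.hasSum_cos (x * ξ)).mul_left _
  rw [← h1.tsum_eq, besselClifford, ← tsum_mul_left]
  refine tsum_congr fun k => ?_
  have h2 : ∀ x : ℝ, (1 - x ^ 2) ^ β * ((-1) ^ k * (x * ξ) ^ (2 * k) / (2 * k).factorial) =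
      ((-1) ^ k * ξ ^ (2 * k) / (2 * k).factorial) * ((1 - x ^ 2) ^ β * x ^ (2 * k)) := by
    intro x; rw [mul_pow]; ring
  simp only [h2]
  rw [intervalIntegral.integral_const_mul, integral_one_sub_sq_rpow_mul_pow hβ]
  -- Legendre duplication converts `Γ(k + 1/2) / (2k)!` into `√π / (4^k k!)`.
  have hd := Real.Gamma_mul_Gamma_add_half ((k : ℝ) + 1 / 2)
  rw [show (k : ℝ) + 1 / 2 + 1 / 2 = k + 1 by ring,
    show 2 * ((k : ℝ) + 1 / 2) = ((2 * k : ℕ) : ℝ) + 1 by push_cast; ring,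
    Real.Gamma_nat_eq_factorial, Real.Gamma_nat_eq_factorial,
    show 1 - (((2 * k : ℕ) : ℝ) + 1) = -((2 * k : ℕ) : ℝ) by ring,
    Real.rpow_neg (by norm_num), Real.rpow_natCast, pow_mul] at hd
  rw [besselCoeff, show β + 1 / 2 + (k : ℝ) + 1 = β + k + 3 / 2 by ring, pow_mul, div_pow]
  have g := (Real.Gamma_pos_of_pos (show 0 < β + k + 3 / 2 by positivity)).ne'
  have f1 : (k.factorial : ℝ) ≠ 0 := by positivity
  have f2 : ((2 * k).factorial : ℝ) ≠ 0 := by positivity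
  generalize Real.Gamma (β + k + 3 / 2) = G at *
  generalize Real.Gamma (k + 1 / 2) = G1 at *
  generalize Real.Gamma (β + 1) = G2 at *
  norm_num at hd
  field_simp at hd ⊢
  linear_combination (ξ ^ 2) ^ k * G2 * hd

/-- Poisson's integral at frequency `2√y` with `|cos| ≤ 1`. This is the domination used in the later
exchanges of integrals. -/
theorem abs_besselClifford_le {ν : ℝ} (hν : 1 / 2 ≤ ν) {y : ℝ} (hy : 0 ≤ y) :
    |besselClifford ν y| ≤ (Real.Gamma (ν + 1))⁻¹ := by
  have hβ : 0 ≤ ν - 1 / 2 := by linarith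
  have h1 := integral_one_sub_sq_rpow_mul_cos hβ (2 * √y)
  have h2 := integral_one_sub_sq_rpow (show -1 < ν - 1 / 2 by linarith)
  rw [show (2 * √y) ^ 2 / 4 = y by rw [mul_pow, Real.sq_sqrt hy]; ring, sub_add_cancel] at h1
  rw [show ν - 1 / 2 + 3 / 2 = ν + 1 by ring] at h2
  have h3 : |∫ x in (-1 : ℝ)..1, (1 - x ^ 2) ^ (ν - 1 / 2) * Real.cos (x * (2 * √y))| ≤
      ∫ x in (-1 : ℝ)..1, (1 - x ^ 2) ^ (ν - 1 / 2) := by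
    rw [← Real.norm_eq_abs]
    refine intervalIntegral.norm_integral_le_of_norm_le (μ := volume) (show (-1 : ℝ) ≤ 1 by norm_num)
      (Filter.Eventually.of_forall fun x hx => ?_)
      ((continuous_one_sub_sq_rpow hβ).intervalIntegrable _ _)
    have h0 : 0 ≤ 1 - x ^ 2 := by nlinarith [hx.1, hx.2]
    rw [norm_mul, Real.norm_eq_abs, Real.norm_eq_abs, abs_of_nonneg (Real.rpow_nonneg h0 _)]
    exact mul_le_of_le_one_right (Real.rpow_nonneg h0 _) (Real.abs_cos_le_one _)
  rw [h1, h2, abs_mul, div_eq_mul_inv (√Real.pi * Real.Gamma (ν - 1 / 2 + 1))] at h3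
  have hp : 0 < √Real.pi * Real.Gamma (ν - 1 / 2 + 1) :=
    mul_pos (Real.sqrt_pos.mpr Real.pi_pos) (Real.Gamma_pos_of_pos (by linarith))
  rw [abs_of_pos hp] at h3
  exact le_of_mul_le_mul_left h3 hp

/-! ### Gegenbauer's formula for the square of a Bessel function -/

/-- Vandermonde's identity with both upper arguments equal to `ν + k`: for `p + q = k`, the product
of the binomials over `p` and `q` is `Γ(ν+k+1)²` times the product of the two Bessel coefficients.
-/
theorem sum_besselCoeff_mul_besselCoeff {ν : ℝ} (hν : 0 ≤ ν) (k : ℕ) :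
    ∑ p ∈ Finset.HasAntidiagonal.antidiagonal k, besselCoeff ν p.1 * besselCoeff ν p.2 =
      besselCoeff ν k * (Real.Gamma (2 * ν + 2 * k + 1) /
        (Real.Gamma (ν + k + 1) * Real.Gamma (2 * ν + k + 1))) := by
  have h := Ring.add_choose_eq k (Commute.all (ν + k : ℝ) (ν + k))
  have g := (Real.Gamma_pos_of_pos (show 0 < ν + k + 1 by positivity)).ne'
  rw [choose_eq_Gamma_div _ _ (show 0 < ν + k + (ν + k) - k + 1 by ring_nf; positivity),
    show ν + k + (ν + k) + 1 = 2 * ν + 2 * k + 1 by ring,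
    show ν + k + (ν + k) - k + 1 = 2 * ν + k + 1 by ring] at h
  have h2 : ∑ p ∈ Finset.HasAntidiagonal.antidiagonal k, Ring.choose (ν + k) p.1 * Ring.choose (ν + k) p.2 =
      Real.Gamma (ν + k + 1) ^ 2 *
        ∑ p ∈ Finset.HasAntidiagonal.antidiagonal k, besselCoeff ν p.1 * besselCoeff ν p.2 := by
    rw [Finset.mul_sum]
    refine Finset.sum_congr rfl fun p hp => ?_
    obtain ⟨i, j⟩ := p
    have hk : k = i + j := (Finset.HasAntidiagonal.mem_antidiagonal.mp hp).symm
    have hk' : (k : ℝ) = i + j := by rw [hk]; push_cast; rfl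
    have e1 : ν + (k : ℝ) - i + 1 = ν + j + 1 := by rw [hk']; ring
    have e2 : ν + (k : ℝ) - j + 1 = ν + i + 1 := by rw [hk']; ring
    have p1 : 0 < ν + i + 1 := by positivity
    have p2 : 0 < ν + j + 1 := by positivity
    rw [choose_eq_Gamma_div _ _ (e1 ▸ p2), choose_eq_Gamma_div _ _ (e2 ▸ p1), e1, e2,
      besselCoeff, besselCoeff]
    have g1 := (Real.Gamma_pos_of_pos p1).ne'
    have g2 := (Real.Gamma_pos_of_pos p2).ne'
    field_simp
  rw [h2] at h
  rw [besselCoeff]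
  have g3 := (Real.Gamma_pos_of_pos (show 0 < 2 * ν + k + 1 by positivity)).ne'
  generalize ∑ p ∈ Finset.HasAntidiagonal.antidiagonal k, besselCoeff ν p.1 * besselCoeff ν p.2 = X at *
  generalize Real.Gamma (ν + k + 1) = G at *
  generalize Real.Gamma (2 * ν + k + 1) = G2 at *
  field_simp at h ⊢
  linarith

theorem integral_pow_mul_beta_weight {ν : ℝ} (hν : 1 / 2 ≤ ν) (k : ℕ) :
    ∫ x in (0 : ℝ)..1, x ^ k * (x ^ (ν - 1 / 2) * (1 - x) ^ (ν - 1 / 2)) =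
      Real.Gamma (ν + k + 1 / 2) * Real.Gamma (ν + 1 / 2) / Real.Gamma (2 * ν + k + 1) := by
  have hk : (0 : ℝ) ≤ k := k.cast_nonneg
  have h := integral_beta (show 0 < ν + k + 1 / 2 by linarith) (show 0 < ν + 1 / 2 by linarith)
  rw [show ν + k + 1 / 2 + (ν + 1 / 2) = 2 * ν + k + 1 by ring] at h
  rw [← h]
  refine intervalIntegral.integral_congr fun x hx => ?_
  rw [Set.uIcc_of_le zero_le_one] at hx
  rw [show ν + k + 1 / 2 - 1 = (ν - 1 / 2) + k by ring, show ν + 1 / 2 - 1 = ν - 1 / 2 by ring]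
  rcases hk.eq_or_lt with h0 | h0
  · have : k = 0 := by exact_mod_cast h0.symm
    simp [this]
  · have hs : 0 < ν - 1 / 2 + k := by linarith
    rw [Real.rpow_add' hx.1 hs.ne', Real.rpow_natCast]
    ring

theorem continuous_beta_weight {ν : ℝ} (hν : 1 / 2 ≤ ν) :
    Continuous fun x : ℝ => x ^ (ν - 1 / 2) * (1 - x) ^ (ν - 1 / 2) :=
  (continuous_id.rpow_const fun _ => Or.inr (by linarith)).mul
    ((continuous_const.sub continuous_id).rpow_const fun _ => Or.inr (by linarith))

theorem beta_weight_nonneg (ν : ℝ) {x : ℝ} (h0 : 0 ≤ x) (h1 : x ≤ 1) :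
    0 ≤ x ^ (ν - 1 / 2) * (1 - x) ^ (ν - 1 / 2) :=
  mul_nonneg (Real.rpow_nonneg h0 _) (Real.rpow_nonneg (by linarith) _)

theorem beta_weight_le_one {ν : ℝ} (hν : 1 / 2 ≤ ν) {x : ℝ} (h0 : 0 ≤ x) (h1 : x ≤ 1) :
    x ^ (ν - 1 / 2) * (1 - x) ^ (ν - 1 / 2) ≤ 1 :=
  mul_le_one₀ (Real.rpow_le_one h0 h1 (by linarith)) (Real.rpow_nonneg (by linarith) _)
    (Real.rpow_le_one (by linarith) (by linarith) (by linarith))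

/-- The constant in Gegenbauer's product formula. -/
noncomputable def productConst (ν : ℝ) : ℝ :=
  (4 : ℝ) ^ ν / (√Real.pi * Real.Gamma (ν + 1 / 2))

theorem productConst_pos {ν : ℝ} (hν : 0 ≤ ν) : 0 < productConst ν := by
  have := Real.Gamma_pos_of_pos (show 0 < ν + 1 / 2 by positivity)
  have := Real.pi_pos
  unfold productConst
  positivity

/-- By duplication the extra factor in the Cauchy square is `4^k` times a `k`-th Beta moment. Hence
squaring the series amounts to averaging it over the arguments `4yx`, with `x` in `(0, 1)`. -/
theorem Gamma_div_Gamma_mul_Gamma_eq {ν : ℝ} (hν : 1 / 2 ≤ ν) (k : ℕ) :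
    Real.Gamma (2 * ν + 2 * k + 1) / (Real.Gamma (ν + k + 1) * Real.Gamma (2 * ν + k + 1)) =
      productConst ν * (4 ^ k *
        ∫ x in (0 : ℝ)..1, x ^ k * (x ^ (ν - 1 / 2) * (1 - x) ^ (ν - 1 / 2))) := by
  have hk : (0 : ℝ) ≤ k := k.cast_nonneg
  rw [integral_pow_mul_beta_weight hν, productConst]
  have hd := Real.Gamma_mul_Gamma_add_half (ν + k + 1 / 2)
  rw [show ν + k + 1 / 2 + 1 / 2 = ν + k + 1 by ring,
    show 2 * (ν + k + 1 / 2) = 2 * ν + 2 * k + 1 by ring,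
    show 1 - (2 * ν + 2 * k + 1) = -(2 * (ν + k)) by ring, Real.rpow_neg (by norm_num),
    Real.rpow_mul (by norm_num), Real.rpow_add (by norm_num), Real.rpow_natCast] at hd
  norm_num at hd
  have g1 := (Real.Gamma_pos_of_pos (show 0 < ν + k + 1 by linarith)).ne'
  have g2 := (Real.Gamma_pos_of_pos (show 0 < 2 * ν + k + 1 by linarith)).ne'
  have g3 := (Real.Gamma_pos_of_pos (show 0 < ν + 1 / 2 by linarith)).ne'
  have hw : (4 : ℝ) ^ ν ≠ 0 := by positivity
  have hpi : √Real.pi ≠ 0 := (Real.sqrt_pos.mpr Real.pi_pos).ne'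
  generalize Real.Gamma (ν + k + 1) = G1 at *
  generalize Real.Gamma (2 * ν + k + 1) = G2 at *
  generalize Real.Gamma (ν + k + 1 / 2) = G3 at *
  generalize Real.Gamma (ν + 1 / 2) = G4 at *
  generalize Real.Gamma (2 * ν + 2 * k + 1) = G5 at *
  field_simp at hd ⊢
  linarith

theorem besselClifford_sq {ν : ℝ} (hν : 1 / 2 ≤ ν) {y : ℝ} (hy : 0 ≤ y) :
    besselClifford ν y ^ 2 = productConst ν * ∫ x in (0 : ℝ)..1,
      besselClifford ν (4 * y * x) * (x ^ (ν - 1 / 2) * (1 - x) ^ (ν - 1 / 2)) := by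
  have hν0 : 0 ≤ ν := by linarith
  have hsum := summable_besselClifford hν0 y
  have hw := continuous_beta_weight hν
  have h1 : HasSum (fun k : ℕ => ∫ x in (0 : ℝ)..1, ((-1) ^ k * besselCoeff ν k * (4 * y * x) ^ k) *
      (x ^ (ν - 1 / 2) * (1 - x) ^ (ν - 1 / 2))) (∫ x in (0 : ℝ)..1,
      besselClifford ν (4 * y * x) * (x ^ (ν - 1 / 2) * (1 - x) ^ (ν - 1 / 2))) := by
    refine intervalIntegral.hasSum_integral_of_dominated_convergence
      (fun (k : ℕ) (_ : ℝ) => besselCoeff ν k * (4 * y) ^ k) (fun k => ?_) (fun k => ?_) ?_ ?_ ?_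
    · exact Continuous.aestronglyMeasurable (by fun_prop)
    · refine Filter.Eventually.of_forall fun x hx => ?_
      rw [Set.uIoc_of_le zero_le_one] at hx
      have hx0 := hx.1.le
      rw [norm_mul, norm_besselClifford_term hν0, abs_of_nonneg (by positivity), Real.norm_eq_abs,
        abs_of_nonneg (beta_weight_nonneg ν hx0 hx.2), mul_pow (4 * y)]
      have e1 := beta_weight_le_one hν hx0 hx.2
      have e2 : x ^ k ≤ 1 := pow_le_one₀ hx0 hx.2
      have e3 := besselCoeff_pos hν0 k
      calc _ ≤ besselCoeff ν k * ((4 * y) ^ k * 1) * 1 := by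
            gcongr
            exact beta_weight_nonneg ν hx0 hx.2
        _ = _ := by ring
    · exact Filter.Eventually.of_forall fun _ _ => summable_besselCoeff_mul_pow hν0 _
    · exact intervalIntegrable_const
    · exact Filter.Eventually.of_forall fun x _ =>
        (summable_besselClifford hν0 (4 * y * x)).hasSum.mul_right _
  rw [← h1.tsum_eq, ← tsum_mul_left, sq, besselClifford,
    tsum_mul_tsum_eq_tsum_sum_antidiagonal_of_summable_norm hsum.norm hsum.norm]
  refine tsum_congr fun k => ?_
  have h2 : ∀ p ∈ Finset.HasAntidiagonal.antidiagonal k, ((-1 : ℝ) ^ p.1 * besselCoeff ν p.1 * y ^ p.1) *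
      ((-1) ^ p.2 * besselCoeff ν p.2 * y ^ p.2) =
      (-1) ^ k * y ^ k * (besselCoeff ν p.1 * besselCoeff ν p.2) := by
    intro p hp
    rw [← Finset.HasAntidiagonal.mem_antidiagonal.mp hp, pow_add, pow_add]
    ring
  rw [Finset.sum_congr rfl h2, ← Finset.mul_sum, sum_besselCoeff_mul_besselCoeff hν0,
    Gamma_div_Gamma_mul_Gamma_eq hν]
  have h3 : ∀ x : ℝ, ((-1) ^ k * besselCoeff ν k * (4 * y * x) ^ k) *
      (x ^ (ν - 1 / 2) * (1 - x) ^ (ν - 1 / 2)) = ((-1) ^ k * besselCoeff ν k * (4 * y) ^ k) *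
      (x ^ k * (x ^ (ν - 1 / 2) * (1 - x) ^ (ν - 1 / 2))) := by
    intro x; rw [mul_pow (4 * y)]; ring
  simp only [h3]
  rw [intervalIntegral.integral_const_mul, mul_pow]
  ring

/-! ### Laplace transforms and the norm of `J_ν` with respect to `dt/t` -/

theorem integrableOn_rpow_mul_exp_neg_mul {a s : ℝ} (ha : -1 < a) (hs : 0 < s) :
    IntegrableOn (fun y : ℝ => y ^ a * Real.exp (-(s * y))) (Set.Ioi 0) := by
  -- The Bochner integral of a non-integrable function is `0`, so a nonzero value proves
  -- integrability.
  refine Integrable.of_integral_ne_zero ?_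
  have h := Real.integral_rpow_mul_exp_neg_mul_Ioi (show 0 < a + 1 by linarith) hs
  rw [add_sub_cancel_right] at h
  rw [h]
  have := Real.Gamma_pos_of_pos (show 0 < a + 1 by linarith)
  positivity

theorem integral_inv_rpow_mul_exp {ν a : ℝ} (hν : 0 < ν) (ha : 0 < a) :
    ∫ s in Set.Ioi (0 : ℝ), s ^ (-ν - 1) * Real.exp (-(a / s)) = Real.Gamma ν * a ^ (-ν) := by
  have h := integral_comp_rpow_Ioi (fun u : ℝ => u ^ (ν - 1) * Real.exp (-(a * u)))
    (show (-1 : ℝ) ≠ 0 by norm_num)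
  rw [Real.integral_rpow_mul_exp_neg_mul_Ioi hν ha, one_div, Real.inv_rpow ha.le,
    ← Real.rpow_neg ha.le] at h
  rw [mul_comm, ← h]
  refine setIntegral_congr_fun measurableSet_Ioi fun s (hs : 0 < s) => ?_
  simp only [smul_eq_mul]
  rw [Real.rpow_neg_one, Real.inv_rpow hs.le, ← Real.rpow_neg hs.le, div_eq_mul_inv, ← mul_assoc]
  congr 1
  rw [abs_neg, abs_one, one_mul, ← Real.rpow_add hs]
  ring_nf

theorem integral_rpow_mul_exp_mul_besselClifford {ν s t : ℝ} (hν : 0 ≤ ν) (hs : 0 < s)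
    (ht : 0 ≤ t) :
    ∫ y in Set.Ioi (0 : ℝ), y ^ ν * Real.exp (-(s * y)) * besselClifford ν (t * y) =
      s ^ (-ν - 1) * Real.exp (-(t / s)) := by
  have hF (k : ℕ) {y : ℝ} (hy : y ∈ Set.Ioi (0 : ℝ)) : y ^ ν * Real.exp (-(s * y)) *
      ((-1) ^ k * besselCoeff ν k * (t * y) ^ k) =
      ((-1) ^ k * besselCoeff ν k * t ^ k) * (y ^ (ν + k) * Real.exp (-(s * y))) := by
    rw [Real.rpow_add hy, Real.rpow_natCast, mul_pow]
    ring
  have hI (k : ℕ) : ∫ y in Set.Ioi (0 : ℝ), y ^ (ν + k) * Real.exp (-(s * y)) =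
      s ^ (-ν - 1) * (s⁻¹) ^ k * Real.Gamma (ν + k + 1) := by
    have h := Real.integral_rpow_mul_exp_neg_mul_Ioi (show 0 < ν + k + 1 by positivity) hs
    rw [add_sub_cancel_right] at h
    rw [h, one_div, show ν + (k : ℝ) + 1 = (ν + 1) + k by ring, Real.rpow_add (inv_pos.mpr hs),
      Real.rpow_natCast, Real.inv_rpow hs.le, ← Real.rpow_neg hs.le]
    ring_nf
  have hc (k : ℕ) : besselCoeff ν k * t ^ k * (s ^ (-ν - 1) * (s⁻¹) ^ k * Real.Gamma (ν + k + 1)) =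
      s ^ (-ν - 1) * ((t / s) ^ k / k.factorial) := by
    have g := (Real.Gamma_pos_of_pos (show 0 < ν + k + 1 by positivity)).ne'
    rw [besselCoeff, div_pow, inv_pow]
    field_simp
  have h1 := hasSum_integral_of_summable_integral_norm (μ := volume.restrict (Set.Ioi (0 : ℝ)))
    (F := fun (k : ℕ) (y : ℝ) => y ^ ν * Real.exp (-(s * y)) *
      ((-1) ^ k * besselCoeff ν k * (t * y) ^ k))
    (fun k => by
      refine IntegrableOn.congr_fun (f := fun y => ((-1) ^ k * besselCoeff ν k * t ^ k) *
        (y ^ (ν + k) * Real.exp (-(s * y)))) ?_ (fun y hy => (hF k hy).symm) measurableSet_Ioi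
      exact (integrableOn_rpow_mul_exp_neg_mul (by linarith [k.cast_nonneg (α := ℝ)]) hs).const_mul _)
    (by
      refine ((Real.summable_pow_div_factorial (t / s)).mul_left (s ^ (-ν - 1))).congr fun k => ?_
      rw [← hc, ← hI, ← integral_const_mul]
      refine setIntegral_congr_fun measurableSet_Ioi fun y hy => ?_
      have hy' : 0 < y := hy
      simp only [hF k hy]
      rw [norm_mul, norm_mul, norm_mul, norm_pow, norm_neg, norm_one, one_pow, one_mul,
        Real.norm_of_nonneg (besselCoeff_pos hν k).le, Real.norm_of_nonneg (by positivity),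
        Real.norm_of_nonneg (by positivity)])
  have h2 : ∫ y in Set.Ioi (0 : ℝ), y ^ ν * Real.exp (-(s * y)) * besselClifford ν (t * y) =
      ∫ y in Set.Ioi (0 : ℝ), ∑' k : ℕ, y ^ ν * Real.exp (-(s * y)) *
      ((-1) ^ k * besselCoeff ν k * (t * y) ^ k) := by
    simp only [tsum_mul_left, besselClifford]
  have hexp : Real.exp (-(t / s)) = ∑' k : ℕ, (-(t / s)) ^ k / k.factorial := by
    rw [Real.exp_eq_exp_ℝ, NormedSpace.exp_eq_tsum_div]
  rw [h2, ← h1.tsum_eq, hexp, ← tsum_mul_left]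
  refine tsum_congr fun k => ?_
  rw [setIntegral_congr_fun measurableSet_Ioi fun y hy => hF k hy, integral_const_mul, hI]
  have := hc k
  rw [neg_pow (t / s)]
  linear_combination (-1) ^ k * this

/-- Tonelli with Bochner inner integrals. Joint integrability is not assumed, so the norm can be
computed before it is known to be finite. -/
theorem lintegral_ofReal_integral_swap {S T : Set ℝ} (hS : MeasurableSet S) (hT : MeasurableSet T)
    {f : ℝ → ℝ → ℝ} (hf : Measurable (Function.uncurry f))
    (h0 : ∀ x ∈ S, ∀ y ∈ T, 0 ≤ f x y) (hx : ∀ x ∈ S, IntegrableOn (f x) T)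
    (hy : ∀ y ∈ T, IntegrableOn (fun x => f x y) S) :
    ∫⁻ x in S, ENNReal.ofReal (∫ y in T, f x y) = ∫⁻ y in T, ENNReal.ofReal (∫ x in S, f x y) := by
  calc ∫⁻ x in S, ENNReal.ofReal (∫ y in T, f x y)
      = ∫⁻ x in S, ∫⁻ y in T, ENNReal.ofReal (f x y) :=
        setLIntegral_congr_fun hS fun x hxS => ofReal_integral_eq_lintegral_ofReal (hx x hxS)
          ((ae_restrict_iff' hT).mpr (Filter.Eventually.of_forall fun y hyT => h0 x hxS y hyT))
    _ = ∫⁻ y in T, ∫⁻ x in S, ENNReal.ofReal (f x y) :=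
        lintegral_lintegral_swap (f := fun x y => ENNReal.ofReal (f x y))
          (hf.ennreal_ofReal.aemeasurable)
    _ = ∫⁻ y in T, ENNReal.ofReal (∫ x in S, f x y) :=
        setLIntegral_congr_fun hT fun y hyT => (ofReal_integral_eq_lintegral_ofReal (hy y hyT)
          ((ae_restrict_iff' hS).mpr (Filter.Eventually.of_forall fun x hxS => h0 x hxS y hyT))).symm

theorem integral_rpow_mul_exp_mul_besselClifford_sq {ν s : ℝ} (hν : 1 / 2 ≤ ν) (hs : 0 < s) :
    ∫ y in Set.Ioi (0 : ℝ), y ^ ν * Real.exp (-(s * y)) * besselClifford ν y ^ 2 =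
      ∫ x in Set.Ioc (0 : ℝ) 1, productConst ν * ((x ^ (ν - 1 / 2) * (1 - x) ^ (ν - 1 / 2)) *
        (s ^ (-ν - 1) * Real.exp (-(4 * x / s)))) := by
  have hν0 : 0 ≤ ν := by linarith
  have hν2 : 0 ≤ ν - 1 / 2 := by linarith
  have hb := continuous_besselClifford hν0
  have hw := continuous_beta_weight hν
  have hyν : Continuous fun y : ℝ => y ^ ν := continuous_id.rpow_const fun _ => Or.inr hν0
  have h1 : ∀ y ∈ Set.Ioi (0 : ℝ), y ^ ν * Real.exp (-(s * y)) * besselClifford ν y ^ 2 =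
      productConst ν * ∫ x in Set.Ioc (0 : ℝ) 1, y ^ ν * Real.exp (-(s * y)) *
        (besselClifford ν (4 * y * x) * (x ^ (ν - 1 / 2) * (1 - x) ^ (ν - 1 / 2))) := by
    intro y hy
    rw [besselClifford_sq hν (le_of_lt hy), integral_const_mul,
      intervalIntegral.integral_of_le zero_le_one]
    ring
  rw [setIntegral_congr_fun measurableSet_Ioi h1, integral_const_mul, integral_const_mul,
    integral_integral_swap]
  · congr 1
    refine setIntegral_congr_fun measurableSet_Ioc fun x hx => ?_
    have h2 := integral_rpow_mul_exp_mul_besselClifford hν0 hs (show 0 ≤ 4 * x by linarith [hx.1])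
    rw [← h2, ← integral_const_mul]
    congr 1
    ext y
    rw [show 4 * y * x = 4 * x * y by ring]
    ring
  · have hB : Integrable (fun z : ℝ × ℝ => (z.1 ^ ν * Real.exp (-(s * z.1))) *
        (Real.Gamma (ν + 1))⁻¹)
        ((volume.restrict (Set.Ioi (0 : ℝ))).prod (volume.restrict (Set.Ioc (0 : ℝ) 1))) :=
      Integrable.mul_prod (f := fun y : ℝ => y ^ ν * Real.exp (-(s * y)))
        (g := fun _ : ℝ => (Real.Gamma (ν + 1))⁻¹)
        (integrableOn_rpow_mul_exp_neg_mul (by linarith) hs) (integrable_const _)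
    refine hB.mono' ?_ ?_
    · exact Continuous.aestronglyMeasurable (by unfold Function.uncurry; fun_prop)
    · rw [Measure.prod_restrict]
      filter_upwards [ae_restrict_mem (measurableSet_Ioi.prod measurableSet_Ioc)] with z hz
      obtain ⟨y, x⟩ := z
      have hy : 0 < y := hz.1
      have hx0 : 0 ≤ x := hz.2.1.le
      have hx1 : x ≤ 1 := hz.2.2
      simp only [Function.uncurry]
      rw [norm_mul, norm_mul (besselClifford _ _), Real.norm_of_nonneg (by positivity),
        Real.norm_eq_abs, Real.norm_of_nonneg (beta_weight_nonneg ν hx0 hx1)]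
      have e1 := abs_besselClifford_le hν (show 0 ≤ 4 * y * x by positivity)
      have e2 := beta_weight_le_one hν hx0 hx1
      have e3 := Real.Gamma_pos_of_pos (show 0 < ν + 1 by linarith)
      calc _ ≤ y ^ ν * Real.exp (-(s * y)) * ((Real.Gamma (ν + 1))⁻¹ * 1) := by
            gcongr
        _ = _ := by rw [mul_one]

/-- Write `1/y = ∫ exp(-sy) ds` and integrate over `y` first. The Beta average of the square formula
has a signed integrand, but its Laplace transform in `y` is `s^(-ν-1) exp(-4x/s)`, which is
positive, so Tonelli applies again. The `s`-integral is `Γ(ν) (4x)^(-ν)`, and `B(1/2, ν + 1/2)`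
remains. -/
theorem lintegral_besselClifford_sq {ν : ℝ} (hν : 1 / 2 ≤ ν) :
    ∫⁻ y in Set.Ioi (0 : ℝ), ENNReal.ofReal (y ^ (ν - 1) * besselClifford ν y ^ 2) =
      ENNReal.ofReal (1 / ν) := by
  have hν0 : 0 < ν := by linarith
  have hb := continuous_besselClifford hν0.le
  have hw := continuous_beta_weight hν
  have hyν : Continuous fun y : ℝ => y ^ ν := continuous_id.rpow_const fun _ => Or.inr hν0.le
  have hC := productConst_pos hν0.le
  have hexp {y : ℝ} (hy : 0 < y) : IntegrableOn (fun s : ℝ => Real.exp (-(s * y))) (Set.Ioi 0) ∧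
      ∫ s in Set.Ioi (0 : ℝ), Real.exp (-(s * y)) = y⁻¹ := by
    have h1 := integrableOn_rpow_mul_exp_neg_mul (show (-1 : ℝ) < 0 by norm_num) hy
    have h2 := Real.integral_rpow_mul_exp_neg_mul_Ioi zero_lt_one hy
    simp only [sub_self, Real.rpow_zero, one_mul, Real.rpow_one, Real.Gamma_one, mul_one,
      one_div, mul_comm y] at h1 h2
    exact ⟨h1, h2⟩
  have step1 : ∫⁻ y in Set.Ioi (0 : ℝ), ENNReal.ofReal (y ^ (ν - 1) * besselClifford ν y ^ 2) =
      ∫⁻ s in Set.Ioi (0 : ℝ), ENNReal.ofReal (∫ y in Set.Ioi (0 : ℝ),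
        y ^ ν * Real.exp (-(s * y)) * besselClifford ν y ^ 2) := by
    rw [← lintegral_ofReal_integral_swap (S := Set.Ioi 0) (T := Set.Ioi 0)
      (f := fun y s => y ^ ν * Real.exp (-(s * y)) * besselClifford ν y ^ 2)
      measurableSet_Ioi measurableSet_Ioi]
    · refine setLIntegral_congr_fun measurableSet_Ioi fun y hy => ?_
      have hy' : 0 < y := hy
      have e : ∀ s : ℝ, y ^ ν * Real.exp (-(s * y)) * besselClifford ν y ^ 2 =
          (y ^ ν * besselClifford ν y ^ 2) * Real.exp (-(s * y)) := fun s => by ring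
      simp only [e]
      rw [integral_const_mul, (hexp hy').2, Real.rpow_sub_one hy'.ne']
      congr 1
      ring
    · exact Continuous.measurable (by unfold Function.uncurry; fun_prop)
    · intro y hy s hs
      have hy' : 0 < y := hy
      positivity
    · intro y hy
      have h := (hexp hy).1.const_mul (y ^ ν * besselClifford ν y ^ 2)
      exact IntegrableOn.congr_fun h (fun s _ => by ring) measurableSet_Ioi
    · intro s hs
      have hs' : 0 < s := hs
      have h := (integrableOn_rpow_mul_exp_neg_mul (show -1 < ν by linarith) hs').mul_const
        (((Real.Gamma (ν + 1))⁻¹) ^ 2)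
      refine h.mono' (Continuous.aestronglyMeasurable (by fun_prop)) ?_
      filter_upwards [ae_restrict_mem measurableSet_Ioi] with y hy
      have hy' : 0 < y := hy
      rw [norm_mul, norm_pow, Real.norm_of_nonneg (by positivity), Real.norm_eq_abs]
      gcongr
      exact abs_besselClifford_le hν hy'.le
  have step2 : ∫⁻ s in Set.Ioi (0 : ℝ), ENNReal.ofReal (∫ y in Set.Ioi (0 : ℝ),
        y ^ ν * Real.exp (-(s * y)) * besselClifford ν y ^ 2) =
      ∫⁻ x in Set.Ioc (0 : ℝ) 1, ENNReal.ofReal (∫ s in Set.Ioi (0 : ℝ), productConst ν *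
        ((x ^ (ν - 1 / 2) * (1 - x) ^ (ν - 1 / 2)) * (s ^ (-ν - 1) * Real.exp (-(4 * x / s))))) := by
    rw [← lintegral_ofReal_integral_swap (S := Set.Ioi 0) (T := Set.Ioc 0 1)
      (f := fun s x => productConst ν *
        ((x ^ (ν - 1 / 2) * (1 - x) ^ (ν - 1 / 2)) * (s ^ (-ν - 1) * Real.exp (-(4 * x / s)))))
      measurableSet_Ioi measurableSet_Ioc]
    · exact setLIntegral_congr_fun measurableSet_Ioi fun s hs => by
        rw [integral_rpow_mul_exp_mul_besselClifford_sq hν hs]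
    · unfold Function.uncurry
      fun_prop
    · intro s hs x hx
      have hs' : 0 < s := hs
      have := beta_weight_nonneg ν hx.1.le hx.2
      positivity
    · intro s hs
      have h : Continuous fun x : ℝ => productConst ν *
        ((x ^ (ν - 1 / 2) * (1 - x) ^ (ν - 1 / 2)) *
          (s ^ (-ν - 1) * Real.exp (-(4 * x / s)))) := by fun_prop
      exact h.integrableOn_Ioc
    · intro x hx
      have h4 : 0 < 4 * x := by linarith [hx.1]
      have h := integral_inv_rpow_mul_exp hν0 h4
      have hi : IntegrableOn (fun s : ℝ => s ^ (-ν - 1) * Real.exp (-(4 * x / s)))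
          (Set.Ioi 0) := by
        refine Integrable.of_integral_ne_zero ?_
        rw [h]
        have := Real.Gamma_pos_of_pos hν0
        positivity
      exact (hi.const_mul _).const_mul _
  have step3 : ∀ x ∈ Set.Ioc (0 : ℝ) 1, ∫ s in Set.Ioi (0 : ℝ), productConst ν *
        ((x ^ (ν - 1 / 2) * (1 - x) ^ (ν - 1 / 2)) * (s ^ (-ν - 1) * Real.exp (-(4 * x / s)))) =
      (Real.Gamma ν / (√Real.pi * Real.Gamma (ν + 1 / 2))) *
        (x ^ ((1 / 2 : ℝ) - 1) * (1 - x) ^ ((ν + 1 / 2) - 1)) := by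
    intro x hx
    have hx0 : 0 < x := hx.1
    rw [integral_const_mul, integral_const_mul, integral_inv_rpow_mul_exp hν0 (by positivity),
      Real.mul_rpow (by norm_num) hx0.le, productConst, Real.rpow_neg (by norm_num),
      show (1 / 2 : ℝ) - 1 = (ν - 1 / 2) + -ν by ring, Real.rpow_add hx0,
      show ν + 1 / 2 - 1 = ν - 1 / 2 by ring]
    have : (4 : ℝ) ^ ν ≠ 0 := by positivity
    field_simp
  rw [step1, step2, setLIntegral_congr_fun measurableSet_Ioc fun x hx => by rw [step3 x hx],
    ← ofReal_integral_eq_lintegral_ofReal]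
  · rw [integral_const_mul, ← intervalIntegral.integral_of_le zero_le_one,
      integral_beta (by norm_num) (by linarith), Real.Gamma_one_half_eq,
      show 1 / 2 + (ν + 1 / 2) = ν + 1 by ring, Real.Gamma_add_one hν0.ne']
    have g1 := (Real.Gamma_pos_of_pos hν0).ne'
    have g2 := (Real.Gamma_pos_of_pos (show 0 < ν + 1 / 2 by linarith)).ne'
    have hpi : √Real.pi ≠ 0 := (Real.sqrt_pos.mpr Real.pi_pos).ne'
    congr 1
    generalize Real.Gamma (ν + 1 / 2) = G at *
    field_simp
  · have h := intervalIntegrable_beta (show (0 : ℝ) < 1 / 2 by norm_num)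
      (show 0 < ν + 1 / 2 by linarith)
    rw [intervalIntegrable_iff, Set.uIoc_of_le zero_le_one] at h
    exact h.const_mul _
  · filter_upwards [ae_restrict_mem measurableSet_Ioc] with x hx
    have g1 := Real.Gamma_pos_of_pos hν0
    have g2 := Real.Gamma_pos_of_pos (show 0 < ν + 1 / 2 by linarith)
    have := hx.1
    have : 0 ≤ 1 - x := by linarith [hx.2]
    simp only [Pi.zero_apply]
    positivity

/-! ### Bessel functions in a logarithmic variable and their orthogonality -/

/-- The Bessel function `J_ν(2 exp(x/2))`. -/
noncomputable def besselExp (ν x : ℝ) : ℝ :=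
  Real.exp (ν * x / 2) * besselClifford ν (Real.exp x)

theorem besselExp_recurrence {ν : ℝ} (hν : 0 ≤ ν) (x : ℝ) :
    Real.exp (x / 2) * besselExp (ν + 2) x =
      (ν + 1) * besselExp (ν + 1) x - Real.exp (x / 2) * besselExp ν x := by
  have e1 : Real.exp ((ν + 1) * x / 2) = Real.exp (x / 2) * Real.exp (ν * x / 2) := by
    rw [← Real.exp_add]; ring_nf
  have e2 : Real.exp ((ν + 2) * x / 2) = Real.exp (x / 2) * Real.exp (x / 2) *
      Real.exp (ν * x / 2) := by
    rw [← Real.exp_add, ← Real.exp_add]; ring_nf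
  have e3 : Real.exp x = Real.exp (x / 2) * Real.exp (x / 2) := by
    rw [← Real.exp_add]; ring_nf
  have h := besselClifford_recurrence hν (Real.exp x)
  simp only [besselExp]
  rw [e1, e2, h]
  linear_combination -(Real.exp (x / 2) * Real.exp (ν * x / 2) *
    besselClifford (ν + 2) (Real.exp x)) * e3

theorem hasDerivAt_besselExp {ν : ℝ} (hν : 0 ≤ ν) (x : ℝ) :
    HasDerivAt (besselExp ν)
      (ν / 2 * besselExp ν x - Real.exp (x / 2) * besselExp (ν + 1) x) x := by
  have h1 : HasDerivAt (fun x : ℝ => Real.exp (ν * x / 2)) (Real.exp (ν * x / 2) * (ν / 2)) x := by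
    have := (((hasDerivAt_id x).const_mul ν).div_const 2).exp
    simpa using this
  have h2 := (hasDerivAt_besselClifford hν (Real.exp x)).comp x (Real.hasDerivAt_exp x)
  refine (h1.mul h2).congr_deriv ?_
  have e1 : Real.exp ((ν + 1) * x / 2) = Real.exp (x / 2) * Real.exp (ν * x / 2) := by
    rw [← Real.exp_add]; ring_nf
  have e3 : Real.exp x = Real.exp (x / 2) * Real.exp (x / 2) := by
    rw [← Real.exp_add]; ring_nf
  simp only [besselExp, Function.comp_apply]
  rw [e1]
  linear_combination -(Real.exp (ν * x / 2) * besselClifford (ν + 1) (Real.exp x)) * e3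

theorem continuous_besselExp {ν : ℝ} (hν : 0 ≤ ν) : Continuous (besselExp ν) :=
  continuous_iff_continuousAt.mpr fun x => (hasDerivAt_besselExp hν x).continuousAt

theorem hasDerivAt_besselExp_succ {ν : ℝ} (hν : 0 ≤ ν) (x : ℝ) :
    HasDerivAt (besselExp (ν + 1))
      (Real.exp (x / 2) * besselExp ν x - (ν + 1) / 2 * besselExp (ν + 1) x) x := by
  refine (hasDerivAt_besselExp (show 0 ≤ ν + 1 by linarith) x).congr_deriv ?_
  have := besselExp_recurrence hν x
  rw [show ν + 1 + 1 = ν + 2 by ring]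
  linarith

theorem lintegral_besselExp_sq {ν : ℝ} (hν : 1 / 2 ≤ ν) :
    ∫⁻ x, ENNReal.ofReal (besselExp ν x ^ 2) = ENNReal.ofReal (1 / ν) := by
  have h := lintegral_image_eq_lintegral_abs_deriv_mul (s := Set.univ) (f := Real.exp)
    (f' := Real.exp) MeasurableSet.univ (fun x _ => (Real.hasDerivAt_exp x).hasDerivWithinAt)
    Real.exp_injective.injOn
    (fun y => ENNReal.ofReal (y ^ (ν - 1) * besselClifford ν y ^ 2))
  rw [Set.image_univ, Real.range_exp, lintegral_besselClifford_sq hν, setLIntegral_univ] at h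
  rw [h]
  refine lintegral_congr fun x => ?_
  rw [← ENNReal.ofReal_mul (abs_nonneg _), abs_of_pos (Real.exp_pos x), ← Real.exp_mul,
    ← mul_assoc, ← Real.exp_add, besselExp, mul_pow, sq (Real.exp _), ← Real.exp_add]
  ring_nf

theorem memLp_besselExp {ν : ℝ} (hν : 1 / 2 ≤ ν) : MemLp (besselExp ν) 2 volume := by
  have hc := continuous_besselExp (show 0 ≤ ν by linarith)
  rw [memLp_two_iff_integrable_sq hc.aestronglyMeasurable]
  refine ⟨(hc.pow 2).aestronglyMeasurable, ?_⟩
  rw [hasFiniteIntegral_iff_ofReal (Filter.Eventually.of_forall fun x => sq_nonneg _),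
    lintegral_besselExp_sq hν]
  exact ENNReal.ofReal_lt_top

theorem integral_besselExp_sq {ν : ℝ} (hν : 1 / 2 ≤ ν) : ∫ x, besselExp ν x ^ 2 = 1 / ν := by
  have hc := continuous_besselExp (show 0 ≤ ν by linarith)
  rw [integral_eq_lintegral_of_nonneg_ae (Filter.Eventually.of_forall fun x => sq_nonneg _)
    (hc.pow 2).aestronglyMeasurable, lintegral_besselExp_sq hν, ENNReal.toReal_ofReal]
  have : 0 < ν := by linarith
  positivity

theorem integrable_besselExp_mul {μ ν : ℝ} (hμ : 1 / 2 ≤ μ) (hν : 1 / 2 ≤ ν) :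
    Integrable fun x => besselExp μ x * besselExp ν x :=
  (memLp_besselExp hμ).integrable_mul (memLp_besselExp hν)

/-- The factor `exp(x/2)` prevents bounding the two products separately. The difference vanishes for
`k = 0`, and by the three-term recurrence two consecutive differences add up to a combination of
integrable products without that factor. -/
theorem integrable_besselExp_cross {ν : ℝ} (hν : 1 / 2 ≤ ν) (k : ℕ) :
    Integrable fun x => Real.exp (x / 2) * (besselExp (ν + 2 * k + 1) x * besselExp ν x -
      besselExp (ν + 2 * k) x * besselExp (ν + 1) x) := by
  induction k with
  | zero => simp [mul_comm]
  | succ k ih =>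
    have hk : (0 : ℝ) ≤ k := k.cast_nonneg
    have h1 := (integrable_besselExp_mul (show 1 / 2 ≤ ν + 2 * k + 2 by linarith) hν).const_mul
      (ν + 2 * k + 2)
    have h2 := (integrable_besselExp_mul (show 1 / 2 ≤ ν + 2 * k + 1 by linarith)
      (show 1 / 2 ≤ ν + 1 by linarith)).const_mul (ν + 2 * k + 1)
    refine ((h1.sub h2).sub ih).congr (Filter.Eventually.of_forall fun x => ?_)
    have r1 := besselExp_recurrence (show 0 ≤ ν + 2 * k by linarith) x
    have r2 := besselExp_recurrence (show 0 ≤ ν + 2 * k + 1 by linarith) x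
    rw [show ν + 2 * (k : ℝ) + 1 + 2 = ν + 2 * k + 3 by ring,
      show ν + 2 * (k : ℝ) + 1 + 1 = ν + 2 * k + 2 by ring] at r2
    rw [show ν + 2 * ((k + 1 : ℕ) : ℝ) + 1 = ν + 2 * k + 3 by push_cast; ring,
      show ν + 2 * ((k + 1 : ℕ) : ℝ) = ν + 2 * k + 2 by push_cast; ring]
    simp only [Pi.sub_apply]
    linear_combination besselExp (ν + 1) x * r1 - besselExp ν x * r2

theorem integral_besselExp_mul_eq_zero {ν : ℝ} (hν : 1 / 2 ≤ ν) {k : ℕ} (hk : k ≠ 0) :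
    ∫ x, besselExp (ν + 2 * k) x * besselExp ν x = 0 := by
  have hk0 : (0 : ℝ) < k := by exact_mod_cast Nat.pos_of_ne_zero hk
  have hν0 : 0 ≤ ν := by linarith
  have hμ0 : 0 ≤ ν + 2 * k := by linarith
  have hprod := integrable_besselExp_mul (show 1 / 2 ≤ ν + 2 * k by linarith) hν
  -- With `μ = ν + 2k` this function is `-2` times the Wronskian `J_μ' J_ν - J_μ J_ν'`, with
  -- derivatives taken in `x`. Its derivative is `-(μ² - ν²)/2` times the product, and `(μ² - ν²)/2
  -- = 2k(ν + k)`. It is integrable together with its derivative, so the derivative has integral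
  -- zero.
  have hV : ∀ x, HasDerivAt (fun x => 2 * (Real.exp (x / 2) *
      (besselExp (ν + 2 * k + 1) x * besselExp ν x -
        besselExp (ν + 2 * k) x * besselExp (ν + 1) x)) -
      2 * k * (besselExp (ν + 2 * k) x * besselExp ν x))
      (-(2 * k * (ν + k)) * (besselExp (ν + 2 * k) x * besselExp ν x)) x := by
    intro x
    have he : HasDerivAt (fun x : ℝ => Real.exp (x / 2)) (Real.exp (x / 2) * (1 / 2)) x :=
      ((hasDerivAt_id x).div_const 2).exp
    have d1 := hasDerivAt_besselExp hν0 x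
    have d2 := hasDerivAt_besselExp hμ0 x
    have d3 := hasDerivAt_besselExp_succ hν0 x
    have d4 := hasDerivAt_besselExp_succ hμ0 x
    refine (((he.mul ((d4.mul d1).sub (d2.mul d3))).const_mul 2).sub
      ((d2.mul d1).const_mul (2 * (k : ℝ)))).congr_deriv ?_
    simp only [Pi.sub_apply, Pi.mul_apply]
    ring
  have h := integral_eq_zero_of_hasDerivAt_of_integrable hV (hprod.const_mul _)
    (((integrable_besselExp_cross hν k).const_mul 2).sub (hprod.const_mul _))
  rw [integral_const_mul] at h
  refine (mul_eq_zero.mp h).resolve_left ?_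
  have : 0 < 2 * k * (ν + k) := by positivity
  linarith

/-! ### The Fourier transform of the basis functions -/

/-- Both transforms satisfy the same duality relation when tested against smooth compactly supported
functions: the `L²` one as a tempered distribution, the integral one by Fubini. -/
theorem fourier_toLp_ae_eq {u : ℝ → ℂ} (hu : MemLp u 2 volume) (hi : Integrable u) :
    (𝓕 hu.toLp : Lp ℂ 2 (volume : Measure ℝ)) =ᵐ[volume] 𝓕 u := by
  have hcont : Continuous (𝓕 u) :=
    VectorFourier.fourierIntegral_continuous Real.continuous_fourierChar
      (L := innerₗ ℝ) continuous_inner hi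
  refine ae_eq_of_integral_contDiff_smul_eq
    ((Lp.memLp _).locallyIntegrable (by norm_num)) hcont.locallyIntegrable fun g hg hgc => ?_
  have hG1 : HasCompactSupport fun x => (g x : ℂ) := hgc.comp_left Complex.ofReal_zero
  have hG2 : ContDiff ℝ (⊤ : ℕ∞) fun x => (g x : ℂ) := Complex.ofRealCLM.contDiff.comp hg
  set G : SchwartzMap ℝ ℂ := hG1.toSchwartzMap hG2
  have hG (x : ℝ) : G x = g x := rfl
  have h1 : ∫ x, g x • (𝓕 hu.toLp : Lp ℂ 2 (volume : Measure ℝ)) x =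
      Lp.toTemperedDistribution (𝓕 hu.toLp : Lp ℂ 2 (volume : Measure ℝ)) G := by
    rw [Lp.toTemperedDistribution_apply]
    simp only [hG, Complex.real_smul, smul_eq_mul]
  rw [h1, ← Lp.fourier_toTemperedDistribution_eq, TemperedDistribution.fourier_apply,
    Lp.toTemperedDistribution_apply]
  have h2 : ∫ x, (𝓕 G) x • (hu.toLp : Lp ℂ 2 (volume : Measure ℝ)) x = ∫ x, (𝓕 G) x • u x := by
    refine integral_congr_ae ?_
    filter_upwards [hu.coeFn_toLp] with x hx
    rw [hx]
  have h3 := VectorFourier.integral_fourierIntegral_smul_eq_flip (L := innerₗ ℝ)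
    Real.continuous_fourierChar continuous_inner (G.integrable (μ := volume)) hi
  have h4 : (innerₗ ℝ : ℝ →ₗ[ℝ] ℝ →ₗ[ℝ] ℝ).flip = innerₗ ℝ := by
    ext; simp
  rw [h4] at h3
  rw [h2]
  simpa [hG, Complex.real_smul, SchwartzMap.fourier_coe] using! h3

theorem hasDerivAt_cexp_neg_mul_I (ω x : ℝ) :
    HasDerivAt (fun x : ℝ => Complex.exp (-(x * ω : ℝ) * Complex.I))
      (-(ω * Complex.I) * Complex.exp (-(x * ω : ℝ) * Complex.I)) x := by
  have h : HasDerivAt (fun x : ℝ => (-(x * ω : ℝ) * Complex.I : ℂ)) (-(ω * Complex.I)) x := by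
    have h1 : HasDerivAt (fun x : ℝ => x * ω) ω x := hasDerivAt_mul_const ω
    exact (h1.ofReal_comp.neg.mul_const Complex.I).congr_deriv (by ring)
  exact h.cexp.congr_deriv (by ring)

theorem integral_one_sub_sq_rpow_mul_cexp {β : ℝ} (hβ : 0 ≤ β) (ω : ℝ) :
    ∫ x in (-1 : ℝ)..1, (((1 - x ^ 2) ^ β : ℝ) : ℂ) * Complex.exp (-(x * ω : ℝ) * Complex.I) =
      ((√Real.pi * Real.Gamma (β + 1) * besselClifford (β + 1 / 2) (ω ^ 2 / 4) : ℝ) : ℂ) := by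
  have hc := continuous_one_sub_sq_rpow hβ
  have hsin : ∫ x in (-1 : ℝ)..1, (1 - x ^ 2) ^ β * Real.sin (x * ω) = 0 := by
    have h : ∫ x in (-1 : ℝ)..1, (1 - x ^ 2) ^ β * Real.sin (x * ω) =
        -∫ x in (-1 : ℝ)..1, (1 - x ^ 2) ^ β * Real.sin (x * ω) := by
      conv_lhs => rw [← neg_neg (1 : ℝ), ← intervalIntegral.integral_comp_neg, neg_neg]
      rw [← intervalIntegral.integral_neg]
      refine intervalIntegral.integral_congr fun x _ => ?_
      simp only [neg_sq, neg_mul, Real.sin_neg, mul_neg]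
    linarith
  rw [← integral_one_sub_sq_rpow_mul_cos hβ, ← intervalIntegral.integral_ofReal]
  have e : ∀ x : ℝ, (((1 - x ^ 2) ^ β : ℝ) : ℂ) * Complex.exp (-(x * ω : ℝ) * Complex.I) =
      (((1 - x ^ 2) ^ β * Real.cos (x * ω) : ℝ) : ℂ) -
        Complex.I * (((1 - x ^ 2) ^ β * Real.sin (x * ω) : ℝ) : ℂ) := by
    intro x
    rw [← Complex.ofReal_neg, Complex.exp_mul_I, ← Complex.ofReal_cos, ← Complex.ofReal_sin,
      Real.cos_neg, Real.sin_neg]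
    push_cast
    ring
  simp only [e]
  rw [intervalIntegral.integral_sub, intervalIntegral.integral_const_mul,
    intervalIntegral.integral_ofReal (f := fun x => (1 - x ^ 2) ^ β * Real.sin (x * ω)), hsin]
  · simp
  · exact Continuous.intervalIntegrable (by fun_prop) _ _
  · exact Continuous.intervalIntegrable (by fun_prop) _ _

/-- The Rodrigues step and one integration by parts replace `(α, n + 1)` by `(α + 1, n)` at the cost
of a factor `-iω / (2(n+1))`; the case `n = 0` is Poisson's integral. -/
theorem integral_jacobiP_mul_cexp (ω : ℝ) (n : ℕ) : ∀ {α : ℝ}, 0 ≤ α →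
    ∫ x in (-1 : ℝ)..1, (((1 - x ^ 2) ^ α * jacobiP α α n x : ℝ) : ℂ) *
        Complex.exp (-(x * ω : ℝ) * Complex.I) =
      (-(ω * Complex.I)) ^ n / (2 ^ n * n.factorial) *
        ((√Real.pi * Real.Gamma (α + n + 1) *
          besselClifford (α + n + 1 / 2) (ω ^ 2 / 4) : ℝ) : ℂ) := by
  induction n with
  | zero =>
    intro α hα
    simpa [jacobiP_zero] using integral_one_sub_sq_rpow_mul_cexp hα ω
  | succ n ih =>
    intro α hα
    have c0 := continuous_one_sub_sq_rpow hα
    have c1 := continuous_one_sub_sq_rpow (show 0 ≤ α + 1 by linarith)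
    have c2 := continuous_jacobiP (α + 1) (α + 1) n
    have c3 := continuous_jacobiP α α (n + 1)
    have c4 := continuous_deriv_jacobiP (α + 1) n
    have hd (x : ℝ) := ((hasDerivAt_jacobiP_deriv (α + 1) n x).ofReal_comp).fun_mul
      (hasDerivAt_cexp_neg_mul_I ω x)
    have key := integral_one_sub_sq_rpow_mul_deriv hα hd (by fun_prop)
    have e : ∀ x ∈ Set.uIcc (-1 : ℝ) 1, (((1 - x ^ 2) ^ α : ℝ) : ℂ) *
        ((1 - (x : ℂ) ^ 2) * (((deriv (jacobiP (α + 1) (α + 1) n) x : ℝ) : ℂ) *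
          Complex.exp (-(x * ω : ℝ) * Complex.I) + (jacobiP (α + 1) (α + 1) n x : ℂ) *
          (-(ω * Complex.I) * Complex.exp (-(x * ω : ℝ) * Complex.I))) -
        2 * (α + 1) * x * ((jacobiP (α + 1) (α + 1) n x : ℂ) *
          Complex.exp (-(x * ω : ℝ) * Complex.I))) =
        (-2 * (n + 1)) * ((((1 - x ^ 2) ^ α * jacobiP α α (n + 1) x : ℝ) : ℂ) *
        Complex.exp (-(x * ω : ℝ) * Complex.I)) +
        (-(ω * Complex.I)) * ((((1 - x ^ 2) ^ (α + 1) * jacobiP (α + 1) (α + 1) n x : ℝ) : ℂ) *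
        Complex.exp (-(x * ω : ℝ) * Complex.I)) := by
      intro x hx
      rw [Set.uIcc_of_le (by norm_num)] at hx
      have h0 : 0 ≤ 1 - x ^ 2 := by nlinarith [hx.1, hx.2]
      have h1 := congrArg (fun r : ℝ => (r : ℂ)) (deriv_jacobiP_raising α n x)
      rw [Real.rpow_add_one' h0 (by linarith)]
      push_cast at h1 ⊢
      linear_combination (((1 - x ^ 2) ^ α : ℝ) : ℂ) *
        Complex.exp (-((x : ℂ) * ω) * Complex.I) * h1
    rw [intervalIntegral.integral_congr e, intervalIntegral.integral_add,
      intervalIntegral.integral_const_mul, intervalIntegral.integral_const_mul,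
      ih (show 0 ≤ α + 1 by linarith)] at key
    · rw [show α + 1 + (n : ℝ) + 1 = α + ((n + 1 : ℕ) : ℝ) + 1 by push_cast; ring,
        show α + 1 + (n : ℝ) + 1 / 2 = α + ((n + 1 : ℕ) : ℝ) + 1 / 2 by push_cast; ring] at key
      have hn : (n : ℂ) + 1 ≠ 0 := by exact_mod_cast n.succ_ne_zero
      refine mul_left_cancel₀ hn ?_
      rw [Nat.factorial_succ]
      generalize ((√Real.pi * Real.Gamma (α + ((n + 1 : ℕ) : ℝ) + 1) *
          besselClifford (α + ((n + 1 : ℕ) : ℝ) + 1 / 2) (ω ^ 2 / 4) : ℝ) : ℂ) = X at *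
      have hf : (n.factorial : ℂ) ≠ 0 := by exact_mod_cast n.factorial_ne_zero
      push_cast at key ⊢
      have e2 : ((n : ℂ) + 1) * ((-(ω * Complex.I)) ^ (n + 1) /
          (2 ^ (n + 1) * ((n + 1) * n.factorial)) * X) =
          (1 / 2) * ((-(ω * Complex.I)) * ((-(ω * Complex.I)) ^ n / (2 ^ n * n.factorial) * X)) := by
        field_simp
        ring
      rw [e2]
      linear_combination (-1 / 2) * key
    · exact Continuous.intervalIntegrable (by fun_prop) _ _
    · exact Continuous.intervalIntegrable (by fun_prop) _ _

/-- The substitution `|ω| = 2 exp(x/2)`. It holds without integrability assumptions, so it also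
transfers integrability whenever the right side is nonzero. -/
theorem integral_abs_rpow_mul_besselClifford (μ ν : ℝ) :
    ∫ ω : ℝ, |ω| ^ (μ + ν - 1) * (besselClifford μ (ω ^ 2 / 4) * besselClifford ν (ω ^ 2 / 4)) =
      2 ^ (μ + ν) * ∫ x, besselExp μ x * besselExp ν x := by
  have h1 := integral_comp_abs (f := fun r : ℝ => r ^ (μ + ν - 1) *
    (besselClifford μ (r ^ 2 / 4) * besselClifford ν (r ^ 2 / 4)))
  simp only [sq_abs] at h1
  have himg : (fun x : ℝ => 2 * Real.exp (x / 2)) '' Set.univ = Set.Ioi 0 := by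
    ext r
    simp only [Set.image_univ, Set.mem_range, Set.mem_Ioi]
    constructor
    · rintro ⟨x, rfl⟩; positivity
    · intro hr
      exact ⟨2 * Real.log (r / 2), by
        rw [mul_div_cancel_left₀ _ (two_ne_zero), Real.exp_log (by positivity)]; ring⟩
  have hd : ∀ x ∈ Set.univ, HasDerivWithinAt (fun x : ℝ => 2 * Real.exp (x / 2))
      (Real.exp (x / 2)) Set.univ x := fun x _ => by
    have : HasDerivAt (fun x : ℝ => 2 * Real.exp (x / 2))
        (2 * (Real.exp (x / 2) * (1 / 2))) x :=
      (((hasDerivAt_id x).div_const 2).exp).const_mul 2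
    exact (this.congr_deriv (by ring)).hasDerivWithinAt
  have hinj : Set.InjOn (fun x : ℝ => 2 * Real.exp (x / 2)) Set.univ := fun x _ y _ h => by
    have h' : Real.exp (x / 2) = Real.exp (y / 2) := by simpa using h
    have := Real.exp_injective h'
    linarith
  have h2 := integral_image_eq_integral_abs_deriv_smul MeasurableSet.univ hd hinj
    (fun r : ℝ => r ^ (μ + ν - 1) *
      (besselClifford μ (r ^ 2 / 4) * besselClifford ν (r ^ 2 / 4)))
  rw [himg, setIntegral_univ] at h2
  rw [h1, h2, ← integral_const_mul, ← integral_const_mul]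
  congr 1
  ext x
  have e1 : (2 * Real.exp (x / 2)) ^ 2 / 4 = Real.exp x := by
    rw [mul_pow, sq (Real.exp _), ← Real.exp_add]; ring_nf
  rw [e1, abs_of_pos (Real.exp_pos _), smul_eq_mul, Real.mul_rpow (by norm_num)
    (Real.exp_pos _).le, ← Real.exp_mul, Real.rpow_sub_one (by norm_num), besselExp, besselExp]
  have e2 : Real.exp (x / 2) * Real.exp (x / 2 * (μ + ν - 1)) =
      Real.exp (μ * x / 2) * Real.exp (ν * x / 2) := by
    rw [← Real.exp_add, ← Real.exp_add]; ring_nf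
  linear_combination 2 ^ (μ + ν) * besselClifford μ (Real.exp x) *
    besselClifford ν (Real.exp x) * e2

theorem integral_besselExp_mul_of_even {ν : ℝ} (hν : 1 / 2 ≤ ν) {i j : ℕ} (h : Even (i + j)) :
    ∫ x, besselExp (ν + i) x * besselExp (ν + j) x = if i = j then 1 / (ν + i) else 0 := by
  wlog hij : j ≤ i generalizing i j
  · have := this (add_comm i j ▸ h) (le_of_not_ge hij)
    simp only [mul_comm (besselExp (ν + i) _), eq_comm (a := i)]
    rw [this]
    split_ifs with h'
    · rw [h']
    · rfl
  have hi : (0 : ℝ) ≤ i := i.cast_nonneg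
  have hj : (0 : ℝ) ≤ j := j.cast_nonneg
  split_ifs with h'
  · subst h'
    simp only [← sq]
    exact integral_besselExp_sq (by linarith)
  · obtain ⟨m, hm⟩ := h
    obtain ⟨k, hk⟩ : ∃ k, i = j + 2 * k := ⟨m - j, by omega⟩
    rw [← integral_besselExp_mul_eq_zero (show 1 / 2 ≤ ν + j by linarith)
      (show k ≠ 0 by omega), hk]
    push_cast
    simp only [add_assoc]

/-! ### Membership of the basis functions in `H^α_*` -/

theorem continuous_basisFun {α : ℝ} (hα : 0 < α) (n : ℕ) : Continuous (basisFun α n) := by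
  have c0 := continuous_one_sub_sq_rpow hα.le
  have c1 := continuous_jacobiP α α n
  unfold basisFun genJacobi
  fun_prop

theorem memLp_zeroExt_basisFun {α : ℝ} (hα : 0 < α) (n : ℕ) (p : ENNReal) :
    MemLp (zeroExt (basisFun α n)) p volume := by
  have hc := continuous_basisFun hα n
  rw [zeroExt, memLp_indicator_iff_restrict (show MeasurableSet Lam from measurableSet_Ioo)]
  obtain ⟨C, hC⟩ := (isCompact_Icc (a := (-1 : ℝ)) (b := 1)).exists_bound_of_continuousOn
    hc.continuousOn
  have : IsFiniteMeasure (volume.restrict Lam) := by unfold Lam; infer_instance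
  refine MemLp.of_bound hc.aestronglyMeasurable C ?_
  filter_upwards [ae_restrict_mem (show MeasurableSet Lam from measurableSet_Ioo)] with x hx
  exact hC x (Set.Ioo_subset_Icc_self hx)

/-- The Fourier transform of the zero extension of `basisFun α n`, with the convention
`∫ f(x) exp(-i x ω) dx`. -/
noncomputable def basisFourier (α : ℝ) (n : ℕ) (ω : ℝ) : ℂ :=
  ((√(Real.pi * (2 * n + 2 * α + 1)) / 2 ^ (α + n + 1 / 2) : ℝ) : ℂ) *
    (-(ω * Complex.I)) ^ n * ((besselClifford (α + n + 1 / 2) (ω ^ 2 / 4) : ℝ) : ℂ)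

theorem continuous_basisFourier {α : ℝ} (hα : 0 < α) (n : ℕ) : Continuous (basisFourier α n) := by
  have := continuous_besselClifford (show 0 ≤ α + n + 1 / 2 by positivity)
  unfold basisFourier
  fun_prop

theorem fourier_zeroExt_basisFun {α : ℝ} (hα : 0 < α) (n : ℕ) (ξ : ℝ) :
    𝓕 (zeroExt (basisFun α n)) ξ = basisFourier α n (2 * Real.pi * ξ) := by
  rw [Real.fourier_real_eq_integral_exp_smul]
  have e1 : ∀ x : ℝ, Complex.exp (↑(-2 * Real.pi * x * ξ) * Complex.I) •
      zeroExt (basisFun α n) x = Lam.indicator (fun x : ℝ =>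
      ((√(2 * n + 2 * α + 1) * (n.factorial : ℝ) /
        ((2 : ℝ) ^ (α + 1 / 2) * Real.Gamma (n + α + 1)) : ℝ) : ℂ) *
      ((((1 - x ^ 2) ^ α * jacobiP α α n x : ℝ) : ℂ) *
        Complex.exp (-(x * (2 * Real.pi * ξ) : ℝ) * Complex.I))) x := by
    intro x
    by_cases hx : x ∈ Lam
    · rw [zeroExt, Set.indicator_of_mem hx, Set.indicator_of_mem hx, basisFun, genJacobi,
        show -2 * Real.pi * x * ξ = -(x * (2 * Real.pi * ξ)) by ring, smul_eq_mul]
      push_cast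
      ring
    · rw [zeroExt, Set.indicator_of_notMem hx, Set.indicator_of_notMem hx, smul_zero]
  simp only [e1]
  rw [integral_indicator (show MeasurableSet Lam from measurableSet_Ioo), Lam,
    ← integral_Ioc_eq_integral_Ioo, ← intervalIntegral.integral_of_le (by norm_num),
    intervalIntegral.integral_const_mul, integral_jacobiP_mul_cexp _ _ hα.le, basisFourier]
  have hG := (Real.Gamma_pos_of_pos (show 0 < α + n + 1 by positivity)).ne'
  have hc : √(2 * n + 2 * α + 1) * (n.factorial : ℝ) /
        ((2 : ℝ) ^ (α + 1 / 2) * Real.Gamma (n + α + 1)) / (2 ^ n * n.factorial) *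
        (√Real.pi * Real.Gamma (α + n + 1)) =
      √(Real.pi * (2 * n + 2 * α + 1)) / 2 ^ (α + n + 1 / 2) := by
    rw [show (n : ℝ) + α + 1 = α + n + 1 by ring, Real.sqrt_mul Real.pi_pos.le,
      show α + (n : ℝ) + 1 / 2 = α + 1 / 2 + n by ring, Real.rpow_add_natCast two_ne_zero]
    have h2 : (2 : ℝ) ^ (α + 1 / 2) ≠ 0 := by positivity
    have hf : (n.factorial : ℝ) ≠ 0 := by positivity
    field_simp
  have hc' := congrArg (fun r : ℝ => (r : ℂ)) hc
  push_cast at hc' ⊢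
  rw [← hc']
  ring

theorem fourier_zeroExtL2_basisFun {α : ℝ} (hα : 0 < α) (n : ℕ) :
    (𝓕 (zeroExtL2 (basisFun α n)) : Lp ℂ 2 (volume : Measure ℝ)) =ᵐ[volume]
      fun ξ => basisFourier α n (2 * Real.pi * ξ) := by
  have hu := memLp_zeroExt_basisFun hα n 2
  have h1 := memLp_one_iff_integrable.mp (memLp_zeroExt_basisFun hα n 1)
  rw [zeroExtL2, dif_pos hu]
  filter_upwards [fourier_toLp_ae_eq hu h1] with ξ hξ
  rw [hξ, fourier_zeroExt_basisFun hα]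

theorem norm_basisFourier_sq (α : ℝ) (n : ℕ) (ω : ℝ) :
    ‖basisFourier α n ω‖ ^ 2 = (√(Real.pi * (2 * n + 2 * α + 1)) / 2 ^ (α + n + 1 / 2)) ^ 2 *
      (|ω| ^ (2 * n) * (besselClifford (α + n + 1 / 2) (ω ^ 2 / 4) *
        besselClifford (α + n + 1 / 2) (ω ^ 2 / 4))) := by
  rw [basisFourier, norm_mul, norm_mul, norm_pow, norm_neg, norm_mul, Complex.norm_I,
    Complex.norm_real, Complex.norm_real, Complex.norm_real, mul_pow, mul_pow, Real.norm_eq_abs,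
    Real.norm_eq_abs, Real.norm_eq_abs, sq_abs, sq_abs, mul_one, ← pow_mul, mul_comm n 2]
  ring

theorem memLp_abs_rpow_mul_basisFourier {α : ℝ} (hα : 0 < α) (n : ℕ) :
    MemLp (fun ξ : ℝ => ((|2 * Real.pi * ξ| ^ α : ℝ) : ℂ) * basisFourier α n (2 * Real.pi * ξ))
      2 volume := by
  have hn : (0 : ℝ) ≤ n := n.cast_nonneg
  have hν : 1 / 2 ≤ α + n + 1 / 2 := by linarith
  have c1 := continuous_basisFourier hα n
  have hα0 : 0 ≤ α := hα.le
  have c2 : Continuous fun ω : ℝ => |ω| ^ α := continuous_abs.rpow_const fun _ => Or.inr hα.le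
  have hmeas : AEStronglyMeasurable (fun ξ : ℝ => ((|2 * Real.pi * ξ| ^ α : ℝ) : ℂ) *
      basisFourier α n (2 * Real.pi * ξ)) volume :=
    Continuous.aestronglyMeasurable (by fun_prop)
  rw [memLp_two_iff_integrable_sq_norm hmeas]
  have h1 := integral_abs_rpow_mul_besselClifford (α + n + 1 / 2) (α + n + 1 / 2)
  have h2 : Integrable (fun ω : ℝ => |ω| ^ ((α + n + 1 / 2) + (α + n + 1 / 2) - 1) *
      (besselClifford (α + n + 1 / 2) (ω ^ 2 / 4) *
        besselClifford (α + n + 1 / 2) (ω ^ 2 / 4))) := by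
    -- The integral is a positive power of two times `1/ν` with `ν = α + n + 1/2`, and a nonzero
    -- Bochner integral forces integrability.
    refine Integrable.of_integral_ne_zero ?_
    simp only [← sq (besselExp _ _)] at h1
    rw [h1, integral_besselExp_sq hν]
    positivity
  have h3 := (h2.const_mul ((√(Real.pi * (2 * n + 2 * α + 1)) / 2 ^ (α + n + 1 / 2)) ^ 2)).comp_mul_left'
    (show 2 * Real.pi ≠ 0 by positivity)
  refine h3.congr (Filter.Eventually.of_forall fun ξ => ?_)
  simp only
  rw [norm_mul, mul_pow ‖_‖ ‖_‖, norm_basisFourier_sq, Complex.norm_real,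
    Real.norm_of_nonneg (by positivity), ← Real.rpow_mul_natCast (abs_nonneg _),
    show α + n + 1 / 2 + (α + n + 1 / 2) - 1 = α * (2 : ℕ) + (2 * n : ℕ) by push_cast; ring,
    Real.rpow_add_natCast' (abs_nonneg _) (by positivity)]
  ring

theorem one_add_sq_rpow_le {s : ℝ} (hs : 0 ≤ s) (ω : ℝ) :
    (1 + ω ^ 2) ^ (s / 2) ≤ 2 ^ (s / 2) * (1 + |ω| ^ s) := by
  have h0 : 0 ≤ |ω| ^ s := by positivity
  have hs2 : 0 ≤ s / 2 := by linarith
  have h2 : (0 : ℝ) ≤ 2 ^ (s / 2) := by positivity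
  rcases le_total (ω ^ 2) 1 with h | h
  · calc (1 + ω ^ 2) ^ (s / 2) ≤ 2 ^ (s / 2) := by gcongr; linarith
      _ ≤ _ := le_mul_of_one_le_right h2 (by linarith)
  · calc (1 + ω ^ 2) ^ (s / 2) ≤ (2 * ω ^ 2) ^ (s / 2) := by gcongr; linarith
      _ = 2 ^ (s / 2) * |ω| ^ s := by
        rw [Real.mul_rpow (by norm_num) (sq_nonneg _), ← sq_abs, ← Real.rpow_natCast_mul
          (abs_nonneg _)]
        congr 2
        push_cast
        ring
      _ ≤ _ := by gcongr; linarith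

theorem memHStar_basisFun {α : ℝ} (hα : 0 < α) (n : ℕ) : MemHStar α (basisFun α n) := by
  refine ⟨memLp_zeroExt_basisFun hα n 2, ?_⟩
  set U : Lp ℂ 2 (volume : Measure ℝ) := 𝓕 (zeroExtL2 (basisFun α n))
  have hU := fourier_zeroExtL2_basisFun hα n
  have h1 : MemLp (fun ξ : ℝ => ((|2 * Real.pi * ξ| ^ α : ℝ) : ℂ) * U ξ) 2 volume :=
    (memLp_congr_ae (by filter_upwards [hU] with ξ hξ; rw [hξ])).mpr
      (memLp_abs_rpow_mul_basisFourier hα n)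
  have h2 := ((Lp.memLp U).norm.add h1.norm)
  have c : Continuous fun ξ : ℝ => (1 + (2 * Real.pi * ξ) ^ 2) ^ (α / 2) :=
    (by fun_prop : Continuous fun ξ : ℝ => 1 + (2 * Real.pi * ξ) ^ 2).rpow_const
      fun _ => Or.inr (by linarith)
  refine h2.of_le_mul (c := 2 ^ (α / 2))
    ((Complex.continuous_ofReal.comp c).aestronglyMeasurable.mul (Lp.aestronglyMeasurable U)) ?_
  refine Filter.Eventually.of_forall fun ξ => ?_
  simp only [Pi.add_apply]
  rw [norm_mul, norm_mul, Complex.norm_real, Complex.norm_real, Real.norm_of_nonneg (by positivity),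
    Real.norm_of_nonneg (by positivity), Real.norm_of_nonneg (by positivity)]
  have h3 := mul_le_mul_of_nonneg_right (one_add_sq_rpow_le hα.le (2 * Real.pi * ξ))
    (norm_nonneg (U ξ))
  linarith

/-! ### The stiffness matrix -/

theorem rieszSymbol_mul_conj (s ω : ℝ) (a b : ℂ) :
    (rieszSymbol s ω * a) * conj (rieszSymbol s ω * b) =
      ((|ω| ^ s * |ω| ^ s : ℝ) : ℂ) * (a * conj b) := by
  have h : ((-1 : ℂ) ^ ⌊(s + 1) / 2⌋) * ((-1 : ℂ) ^ ⌊(s + 1) / 2⌋) = 1 := by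
    rw [← mul_zpow]; norm_num
  rw [rieszSymbol]
  simp only [map_mul, map_zpow₀, map_neg, map_one, Complex.conj_ofReal]
  push_cast
  linear_combination ((|ω| ^ s : ℝ) : ℂ) * ((|ω| ^ s : ℝ) : ℂ) * a * conj b * h

theorem innerOn_rieszDeriv_basisFun {α : ℝ} (hα : 0 < α) (i j : ℕ) :
    innerOn Set.univ (rieszDeriv α (basisFun α j)) (rieszDeriv α (basisFun α i)) =
      (((2 * Real.pi)⁻¹ : ℝ) : ℂ) * ∫ ω : ℝ, ((|ω| ^ α * |ω| ^ α : ℝ) : ℂ) *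
        (basisFourier α j ω * conj (basisFourier α i ω)) := by
  have hm (n : ℕ) : MemLp (fun ξ : ℝ => rieszSymbol α (2 * Real.pi * ξ) *
      (𝓕 (zeroExtL2 (basisFun α n)) : Lp ℂ 2 (volume : Measure ℝ)) ξ) 2 volume := by
    have h := (memLp_abs_rpow_mul_basisFourier hα n).const_mul ((-1 : ℂ) ^ ⌊(α + 1) / 2⌋)
    refine (memLp_congr_ae ?_).mpr h
    filter_upwards [fourier_zeroExtL2_basisFun hα n] with ξ hξ
    rw [hξ, rieszSymbol, mul_assoc]
  -- The `L²` inner product is conjugate linear in its first argument, hence the exchange of `i` and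
  -- `j`.
  have h1 : innerOn Set.univ (rieszDeriv α (basisFun α j)) (rieszDeriv α (basisFun α i)) =
      inner ℂ (rieszDeriv α (basisFun α i)) (rieszDeriv α (basisFun α j)) := by
    rw [L2.inner_def, innerOn, Measure.restrict_univ]
    rfl
  rw [h1, rieszDeriv, rieszDeriv, dif_pos (hm i), dif_pos (hm j), ← Lp.inner_fourier_eq,
    fourier_fourierInv_eq, fourier_fourierInv_eq, L2.inner_def]
  have h2 := Measure.integral_comp_mul_left (fun ω : ℝ => ((|ω| ^ α * |ω| ^ α : ℝ) : ℂ) *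
        (basisFourier α j ω * conj (basisFourier α i ω))) (2 * Real.pi)
  rw [abs_of_pos (by positivity), Complex.real_smul] at h2
  rw [← h2]
  refine integral_congr_ae ?_
  filter_upwards [(hm i).coeFn_toLp, (hm j).coeFn_toLp, fourier_zeroExtL2_basisFun hα i,
    fourier_zeroExtL2_basisFun hα j] with ξ h3 h4 h5 h6
  rw [h3, h4, h5, h6, RCLike.inner_apply, rieszSymbol_mul_conj]

theorem innerOn_rieszDeriv_basisFun_eq {α : ℝ} (hα : 0 < α) (i j : ℕ) :
    innerOn Set.univ (rieszDeriv α (basisFun α j)) (rieszDeriv α (basisFun α i)) =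
      if i = j then 1 else 0 := by
  rw [innerOn_rieszDeriv_basisFun hα]
  set K : ℕ → ℝ := fun n => √(Real.pi * (2 * n + 2 * α + 1)) / 2 ^ (α + n + 1 / 2) with hK
  set b : ℕ → ℝ → ℝ := fun n ω => besselClifford (α + n + 1 / 2) (ω ^ 2 / 4) with hb
  have hF (ω : ℝ) : ((|ω| ^ α * |ω| ^ α : ℝ) : ℂ) *
      (basisFourier α j ω * conj (basisFourier α i ω)) =
      ((K i * K j : ℝ) : ℂ) * (Complex.I ^ i * (-Complex.I) ^ j) *
        ((|ω| ^ α * |ω| ^ α * ω ^ (i + j) * (b i ω * b j ω) : ℝ) : ℂ) := by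
    have e : (basisFourier α j ω * conj (basisFourier α i ω)) =
        ((K j : ℂ) * (-(ω * Complex.I)) ^ j * (b j ω : ℂ)) *
        ((K i : ℂ) * (ω * Complex.I) ^ i * (b i ω : ℂ)) := by
      simp only [basisFourier, map_mul, map_pow, map_neg, Complex.conj_ofReal, Complex.conj_I, hK,
        hb, mul_neg, neg_neg]
    rw [e, neg_mul_eq_mul_neg, mul_pow, mul_pow]
    push_cast
    ring
  simp only [hF]
  rw [integral_const_mul, integral_complex_ofReal]
  by_cases h : Even (i + j)
  -- Evenness of `i + j` allows `|ω|` in place of `ω`, and the two shifts by `1/2` in the Bessel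
  -- orders absorb the `-1` in the exponent.
  · have e1 (ω : ℝ) : |ω| ^ α * |ω| ^ α * ω ^ (i + j) * (b i ω * b j ω) =
        |ω| ^ ((α + i + 1 / 2) + (α + j + 1 / 2) - 1) * (b i ω * b j ω) := by
      rw [show (α + i + 1 / 2) + (α + j + 1 / 2) - 1 = α + α + ((i + j : ℕ) : ℝ) by
        push_cast; ring, Real.rpow_add_natCast' (abs_nonneg _) (by positivity),
        Real.rpow_add' (abs_nonneg _) (by positivity), h.pow_abs]
    simp only [e1]
    simp only [hb]
    rw [integral_abs_rpow_mul_besselClifford]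
    have h3 := integral_besselExp_mul_of_even (show 1 / 2 ≤ α + 1 / 2 by linarith) h
    rw [show α + i + 1 / 2 = α + 1 / 2 + i by ring, show α + j + 1 / 2 = α + 1 / 2 + j by ring, h3]
    split_ifs with hij
    · subst hij
      have e2 : Complex.I ^ i * (-Complex.I) ^ i = 1 := by
        rw [← mul_pow]; simp
      have e3 : K i * K i = Real.pi * (2 * i + 2 * α + 1) / 2 ^ (α + 1 / 2 + i + (α + 1 / 2 + i)) := by
        simp only [hK]
        rw [div_mul_div_comm, Real.mul_self_sqrt (by positivity), ← Real.rpow_add two_pos]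
        ring_nf
      rw [e2, e3]
      norm_cast
      have hi : (0 : ℝ) ≤ i := i.cast_nonneg
      have hw : (2 : ℝ) ^ (α + 1 / 2 + i + (α + 1 / 2 + i)) ≠ 0 := by positivity
      have hn : α + 1 / 2 + i ≠ 0 := by positivity
      have hpi := Real.pi_ne_zero
      generalize (2 : ℝ) ^ (α + 1 / 2 + i + (α + 1 / 2 + i)) = w at *
      push_cast
      field_simp
      ring
    · simp
  -- Here the zero comes from the oddness of the integrand on the line, not from Bessel
  -- orthogonality.
  · have hij : i ≠ j := fun h' => h (h' ▸ ⟨i, rfl⟩)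
    have h1 := integral_neg_eq_self
      (fun ω : ℝ => |ω| ^ α * |ω| ^ α * ω ^ (i + j) * (b i ω * b j ω)) volume
    have h2 (ω : ℝ) : |(-ω)| ^ α * |(-ω)| ^ α * (-ω) ^ (i + j) * (b i (-ω) * b j (-ω)) =
        -(|ω| ^ α * |ω| ^ α * ω ^ (i + j) * (b i ω * b j ω)) := by
      simp only [hb, abs_neg, neg_sq, (Nat.not_even_iff_odd.mp h).neg_pow]
      ring
    simp only [h2] at h1
    rw [integral_neg] at h1
    rw [show ∫ ω : ℝ, |ω| ^ α * |ω| ^ α * ω ^ (i + j) * (b i ω * b j ω) = 0 by linarith,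
      if_neg hij]
    simp

end RieszJacobi


theorem mainTheorem7 (α : ℝ) (hα : 0 < α) (N : ℕ) :
    (∀ n : ℕ, RieszJacobi.MemHStar α (RieszJacobi.basisFun α n)) ∧
    (∀ i j : Fin (N + 1),
      RieszJacobi.stiffness α N i j = if i = j then 1 else 0) ∧
    (∀ i j : Fin (N + 1),
      RieszJacobi.massMatrix α N i j =
        if Even ((i : ℕ) + (j : ℕ)) then ((RieszJacobi.massEntry α i j : ℝ) : ℂ) else 0) := by
  refine ⟨RieszJacobi.memHStar_basisFun hα, fun i j => ?_, fun i j => ?_⟩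
  · rw [RieszJacobi.stiffness, RieszJacobi.innerOn_rieszDeriv_basisFun_eq hα]
    simp only [Fin.ext_iff]
  · rw [RieszJacobi.massMatrix]
    split_ifs with h
    · exact RieszJacobi.innerOn_basisFun_of_even hα h
    · exact RieszJacobi.innerOn_basisFun_of_odd α h
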